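/- Let $p$ be a prime. For $h\in\mathbb{N}$ call a subset of $\mathbb{Q}_p$ \emph{uniformly measurable of radius $h$} if it is a union of cosets of $p^h\mathbb{Z}_p$, and \emph{uniformly measurable} if it is so of some radius $h\in\mathbb{N}$. Let $\mathscr{D}=\mathscr{D}_{\rm unif}(\mathbb{Q}_p,\mathbb{Z}_p)$ be the set of $\mathbb{Z}_p$-valued functions $\mu$ on the uniformly measurable sets such that, for every $h$ and every disjoint family $(U_\alpha)_\alpha$ of uniformly measurable sets of radius $h$, the series $\sum_\alpha\mu(U_\alpha)$ converges unconditionally to $\mu(\bigcup_\alpha U_\alpha)$. It is a commutative $\mathbb{Z}_p$-algebra under convolution, with unit the Dirac mass $\Delta_0$, and it carries its natural topology of uniform convergence on the uniformly measurable sets of the same radius (a basis of neighbourhoods of $0$ is given by the sets $\{\mu : \mu(U)\in p^{\ell}\mathbb{Z}_p \text{ for all } U \text{ of radius } h\}$, $h,\ell\in\mathbb{N}$). Put $S=\mathbb{Z}[1/p]\cap\mathbb{R}_{\ge 0}$, let $v$ be the $p$-adic valuation ($v(0)=\infty$), let $T_n=\Delta_{1/p^n}-\Delta_0$ and $\widetilde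 T_n=\lim_{m\to\infty}T_{n+m}^{p^m}$; these limits exist in the $p$-adic topology of $\mathscr{D}$. With $\widetilde T=\widetilde T_0$, the definition $\widetilde T^{m/p^n}:=\widetilde T_n^{\,m}$ is unambiguous for $m/p^n\in S$. Let $\mathbb{Z}[\widetilde T^{1/p^\infty}]$ be the subring of $\mathscr{D}$ generated by all $\widetilde T_n$. Then: 1. Every element of $\mathbb{Z}[\widetilde T^{1/p^\infty}]$ is a unique finite sum $\sum_{q\in S}a_q\widetilde T^q$ with $a_q\in\mathbb{Z}$, the formula $w(\sum_q a_q\widetilde T^q)=\min_{q\in S}(v(a_q)+q)$ defines a valuation on this ring, and the topological ring $\mathscr{D}$ is its $w$-completion: $\mathscr{D}$ is separated and complete, $\mathbb{Z}[\widetilde T^{1/p^\infty}]$ is dense in $\mathscr{D}$, and the uniformity of $\mathscr{D}$ induces on it the one defined by $w$. 2. Every element of $\mathscr{D}$ is the sum of a unique $S$-series $\sum_{q\in S}a_q\widetilde T^q$ with $a_q\in\mathbb{Z}_p$ such that, for every $C>0$, $v(a_q)+q>C$ for all but finitely many $q\in S$. Conversely, every $S$-series with this property converges unconditionally in $\mathscr{D}$.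 3. The formula $w(\sum_{q\in S}a_q\widetilde T^q)=\min_{q\in S}(v(a_q)+q)$ (for the series in 2) defines a valuation on $\mathscr{D}$, with values in $S\cup\{\infty\}$, and the topology that it induces coincides with the $(p,\widetilde T)$-adic topology of $\mathscr{D}$ and with its natural topology. -/

import Mathlib

noncomputable section

open Filter Topology Set

namespace PadicMeasures

variable (p : ℕ) [Fact p.Prime]

/-- The subgroup `p ^ h ℤ_p` of `ℚ_p`. -/
def ballSubgroup (h : ℕ) : AddSubgroup ℚ_[p] where
  carrier := {x | ‖x‖ ≤ (p : ℝ) ^ (-(h : ℤ))}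
  zero_mem' := by simp
  add_mem' := fun {a b} ha hb => (IsUltrametricDist.norm_add_le_max a b).trans (max_le ha hb)
  neg_mem' := fun {a} ha => by simpa using ha

/-- The discrete quotient group `ℚ_p / p ^ h ℤ_p`, whose points are the balls of radius `h`. -/
abbrev Balls (h : ℕ) : Type := ℚ_[p] ⧸ ballSubgroup p h

/-- The quotient map `π_h : ℚ_p → ℚ_p / p ^ h ℤ_p`. -/
def proj (h : ℕ) (x : ℚ_[p]) : Balls p h := QuotientAddGroup.mk x

/-- The uniformly measurable subsets of radius `h`: arbitrary unions of cosets of `p ^ h ℤ_p`. -/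
def unifSetsOfRadius (h : ℕ) : Set (Set ℚ_[p]) :=
  {U | ∃ V : Set (Balls p h), U = proj p h ⁻¹' V}

/-- The uniformly measurable subsets of `ℚ_p`. -/
def unifSets : Set (Set ℚ_[p]) := ⋃ h : ℕ, unifSetsOfRadius p h

variable {p}

theorem proj_surjective (h : ℕ) : Function.Surjective (proj p h) :=
  Quotient.mk_surjective

theorem mem_unifSets {h : ℕ} {U : Set ℚ_[p]} (hU : U ∈ unifSetsOfRadius p h) : U ∈ unifSets p :=
  mem_iUnion.2 ⟨h, hU⟩

theorem iUnion_mem {h : ℕ} {ι : Type} {U : ι → Set ℚ_[p]} (hU : ∀ i, U i ∈ unifSetsOfRadius p h) :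
    (⋃ i, U i) ∈ unifSetsOfRadius p h := by
  choose V hV using hU
  exact ⟨⋃ i, V i, by rw [preimage_iUnion]; exact iUnion_congr hV⟩

variable (p)

/-- The uniform `ℤ_p`-valued measures on `ℚ_p`: functions `μ` on the uniformly measurable sets such
that for every disjoint family of uniformly measurable sets of one and the same radius the family of
the measures is unconditionally summable, with sum the measure of the union. -/
@[ext]
structure UnifMeasure where
  /-- The underlying set function. -/
  toFun : unifSets p → ℤ_[p]
  hasSum_iUnion : ∀ (h : ℕ) (ι : Type) (U : ι → Set ℚ_[p]) (hU : ∀ i, U i ∈ unifSetsOfRadius p h),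
    Pairwise (fun i j => Disjoint (U i) (U j)) →
      HasSum (fun i => toFun ⟨U i, mem_unifSets (hU i)⟩)
        (toFun ⟨⋃ i, U i, mem_unifSets (iUnion_mem hU)⟩)

variable {p}

namespace UnifMeasure

/-- The set `π_h⁻¹(V)` as a uniformly measurable set. -/
def cyl (h : ℕ) (V : Set (Balls p h)) : unifSets p := ⟨proj p h ⁻¹' V, mem_unifSets ⟨V, rfl⟩⟩

/-- The measure of a ball of radius `h`. -/
def ball (μ : UnifMeasure p) (h : ℕ) (c : Balls p h) : ℤ_[p] := μ.toFun (cyl h {c})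

/-- The group operations on measures are those of their values. -/
instance : Zero (UnifMeasure p) := ⟨⟨0, fun _ _ _ _ _ => hasSum_zero⟩⟩

instance : Add (UnifMeasure p) :=
  ⟨fun μ ν => ⟨μ.toFun + ν.toFun, fun h ι U hU hd =>
    (μ.hasSum_iUnion h ι U hU hd).add (ν.hasSum_iUnion h ι U hU hd)⟩⟩

instance : Neg (UnifMeasure p) :=
  ⟨fun μ => ⟨-μ.toFun, fun h ι U hU hd => (μ.hasSum_iUnion h ι U hU hd).neg⟩⟩

instance : Sub (UnifMeasure p) :=
  ⟨fun μ ν => ⟨μ.toFun - ν.toFun, fun h ι U hU hd =>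
    (μ.hasSum_iUnion h ι U hU hd).sub (ν.hasSum_iUnion h ι U hU hd)⟩⟩

instance : SMul ℤ_[p] (UnifMeasure p) :=
  ⟨fun a μ => ⟨a • μ.toFun, fun h ι U hU hd => (μ.hasSum_iUnion h ι U hU hd).mul_left a⟩⟩

instance : SMul ℕ (UnifMeasure p) :=
  ⟨fun a μ => ⟨a • μ.toFun, fun h ι U hU hd => (μ.hasSum_iUnion h ι U hU hd).const_smul a⟩⟩

instance : SMul ℤ (UnifMeasure p) :=
  ⟨fun a μ => ⟨a • μ.toFun, fun h ι U hU hd => (μ.hasSum_iUnion h ι U hU hd).const_smul a⟩⟩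

theorem toFun_injective : Function.Injective (toFun : UnifMeasure p → unifSets p → ℤ_[p]) :=
  fun _ _ h => UnifMeasure.ext h

instance : AddCommGroup (UnifMeasure p) :=
  toFun_injective.addCommGroup _ rfl (fun _ _ => rfl) (fun _ => rfl) (fun _ _ => rfl)
    (fun _ _ => rfl) (fun _ _ => rfl)

/-- The additive homomorphism underlying `toFun`. -/
def toFunHom : UnifMeasure p →+ (unifSets p → ℤ_[p]) where
  toFun := toFun
  map_zero' := rfl
  map_add' _ _ := rfl

instance : Module ℤ_[p] (UnifMeasure p) :=
  toFun_injective.module ℤ_[p] toFunHom (fun _ _ => rfl)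

open Classical in
/-- The Dirac mass at `x`. -/
def dirac (x : ℚ_[p]) : UnifMeasure p where
  toFun U := if x ∈ U.1 then 1 else 0
  hasSum_iUnion h ι U hU hd := by
    by_cases hx : ∃ i, x ∈ U i
    · obtain ⟨i, hi⟩ := hx
      have h1 : x ∈ ⋃ i, U i := mem_iUnion.2 ⟨i, hi⟩
      simp only [h1, if_true]
      have := hasSum_single (f := fun j => if x ∈ U j then (1 : ℤ_[p]) else 0) i (fun j hj => by
        have : x ∉ U j := fun hxj => (disjoint_left.1 (hd hj)) hxj hi
        simp [this])
      simpa [hi] using this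
    · have h1 : x ∉ ⋃ i, U i := fun h => hx (mem_iUnion.1 h)
      have h2 : ∀ i, x ∉ U i := fun i h => hx ⟨i, h⟩
      simp only [h1, h2, if_false]
      exact hasSum_zero

theorem hasSum_cyl (μ : UnifMeasure p) (h : ℕ) (V : Set (Balls p h)) :
    HasSum (V.indicator (μ.ball h)) (μ.toFun (cyl h V)) := by
  rw [← hasSum_subtype_iff_indicator]
  have := μ.hasSum_iUnion h V (fun c => proj p h ⁻¹' {c.1}) (fun c => ⟨_, rfl⟩) (fun c d hcd => by
    refine Disjoint.preimage _ ?_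
    simpa using fun h => hcd (Subtype.ext h))
  convert! this using 2
  refine Subtype.ext ?_
  ext x
  simp [cyl]

theorem hasSum_ball (μ : UnifMeasure p) (h : ℕ) :
    HasSum (μ.ball h) (μ.toFun (cyl h univ)) := by
  simpa using μ.hasSum_cyl h univ

/-- For `h ≤ h'` the projection `ℚ_p / p ^ h' ℤ_p → ℚ_p / p ^ h ℤ_p`. -/
def transition {h h' : ℕ} (hh : h ≤ h') : Balls p h' →+ Balls p h :=
  QuotientAddGroup.map _ _ (AddMonoidHom.id _) (fun x hx => by
    refine le_trans (α := ℝ) hx ?_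
    have : (1 : ℝ) ≤ p := by exact_mod_cast (Fact.out : p.Prime).one_lt.le
    exact zpow_le_zpow_right₀ this (by omega))

theorem transition_proj {h h' : ℕ} (hh : h ≤ h') (x : ℚ_[p]) :
    transition hh (proj p h' x) = proj p h x := rfl

theorem cyl_transition {h h' : ℕ} (hh : h ≤ h') (V : Set (Balls p h)) :
    cyl h' (transition hh ⁻¹' V) = cyl h V := rfl

instance : NonarchimedeanRing ℤ_[p] where
  is_nonarchimedean := NonarchimedeanAddGroup.is_nonarchimedean

/-- The value at `π_h⁻¹(V)` of the convolution of `μ` and `ν`, which is the value of the product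
measure `μ × ν` at `{(x, y) | x + y ∈ π_h⁻¹(V)}`. -/
def convAt (μ ν : UnifMeasure p) (h : ℕ) (V : Set (Balls p h)) : ℤ_[p] :=
  ∑' c : Balls p h × Balls p h,
    {c : Balls p h × Balls p h | c.1 + c.2 ∈ V}.indicator (fun c => μ.ball h c.1 * ν.ball h c.2) c

theorem summable_conv (μ ν : UnifMeasure p) (h : ℕ) :
    Summable (fun c : Balls p h × Balls p h => μ.ball h c.1 * ν.ball h c.2) :=
  ((μ.hasSum_ball h).mul_of_nonarchimedean (ν.hasSum_ball h)).summable

theorem hasSum_convAt (μ ν : UnifMeasure p) (h : ℕ) (V : Set (Balls p h)) :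
    HasSum ({c : Balls p h × Balls p h | c.1 + c.2 ∈ V}.indicator
      (fun c => μ.ball h c.1 * ν.ball h c.2)) (convAt μ ν h V) :=
  ((summable_conv μ ν h).indicator _).hasSum

theorem convAt_transition (μ ν : UnifMeasure p) {h h' : ℕ} (hh : h ≤ h') (V : Set (Balls p h)) :
    convAt μ ν h' (transition hh ⁻¹' V) = convAt μ ν h V := by
  have h1 := (hasSum_convAt μ ν h' (transition hh ⁻¹' V)).tsum_fiberwise
    (fun c => (transition hh c.1, transition hh c.2))
  refine (h1.unique ?_)
  convert! hasSum_convAt μ ν h V using 1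
  ext ⟨c, d⟩
  have hc := μ.hasSum_cyl h' (transition hh ⁻¹' {c})
  have hd := ν.hasSum_cyl h' (transition hh ⁻¹' {d})
  have hcd := hc.mul_of_nonarchimedean hd
  rw [cyl_transition, cyl_transition] at hcd
  rw [tsum_subtype]
  by_cases hV : c + d ∈ V
  · rw [indicator_of_mem (by exact hV)]
    refine HasSum.tsum_eq ?_
    convert! hcd using 1
    ext ⟨c', d'⟩
    classical
    simp only [indicator_apply, mem_preimage, mem_singleton_iff, Prod.mk.injEq, mem_ofPred_eq, map_add]
    by_cases h1 : transition hh c' = c <;> by_cases h2 : transition hh d' = d <;> simp [h1, h2, hV]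
  · rw [indicator_of_notMem (by exact hV)]
    refine HasSum.tsum_eq ?_
    convert! hasSum_zero using 1
    ext ⟨c', d'⟩
    classical
    simp only [indicator_apply, mem_preimage, mem_singleton_iff, Prod.mk.injEq, mem_ofPred_eq, map_add]
    by_cases h1 : transition hh c' = c <;> by_cases h2 : transition hh d' = d <;> simp [h1, h2, hV]

theorem proj_image_preimage {h : ℕ} (V : Set (Balls p h)) : proj p h '' (proj p h ⁻¹' V) = V :=
  image_preimage_eq _ (proj_surjective h)

/-- The value at `U` of the convolution of `μ` and `ν`; see `convFun_eq` for the independence of the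
choice of a radius of `U`. -/
def convFun (μ ν : UnifMeasure p) (U : unifSets p) : ℤ_[p] :=
  convAt μ ν (mem_iUnion.1 U.2).choose (proj p _ '' U.1)

theorem convFun_eq (μ ν : UnifMeasure p) (h : ℕ) (V : Set (Balls p h)) :
    convFun μ ν (cyl h V) = convAt μ ν h V := by
  unfold convFun
  generalize_proofs hex
  obtain ⟨W, hW⟩ := hex.choose_spec
  generalize hex.choose = h₀ at *
  rw [hW, proj_image_preimage]
  rw [← convAt_transition μ ν (le_max_left h h₀), ← convAt_transition μ ν (le_max_right h h₀)]
  congr 1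
  have h2 : proj p (max h h₀) ⁻¹' (transition (le_max_right h h₀) ⁻¹' W)
      = proj p (max h h₀) ⁻¹' (transition (le_max_left h h₀) ⁻¹' V) := hW.symm
  exact (proj_surjective _).preimage_injective h2

/-- The product of uniform measures is convolution. -/
instance : Mul (UnifMeasure p) := ⟨fun μ ν =>
  { toFun := convFun μ ν
    hasSum_iUnion := fun h ι U hU hd => by
      have hU2 := hU
      choose V hV using hU2
      obtain rfl : U = fun i => proj p h ⁻¹' V i := funext hV
      have e1 : ∀ i, convFun μ ν ⟨proj p h ⁻¹' V i, mem_unifSets ⟨V i, rfl⟩⟩ = convAt μ ν h (V i) :=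
        fun i => convFun_eq μ ν h (V i)
      have e2 : convFun μ ν ⟨⋃ i, proj p h ⁻¹' V i, mem_unifSets (iUnion_mem fun i => ⟨V i, rfl⟩)⟩
          = convAt μ ν h (⋃ i, V i) := by
        rw [← convFun_eq]
        congr 1
        exact Subtype.ext preimage_iUnion.symm
      rw [e2]
      simp only [e1]
      have hdV : ∀ {c i j}, c ∈ V i → c ∈ V j → i = j := by
        intro c i j hi hj
        by_contra hij
        obtain ⟨x, rfl⟩ := proj_surjective h c
        exact disjoint_left.1 (hd hij) hi hj
      have H := hasSum_convAt μ ν h (⋃ i, V i)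
      rw [← hasSum_subtype_iff_indicator] at H
      have hidx : ∀ c : {c : Balls p h × Balls p h | c.1 + c.2 ∈ ⋃ i, V i},
          ∃ i, c.1.1 + c.1.2 ∈ V i := fun c => mem_iUnion.1 c.2
      choose idx hidx using hidx
      convert! H.tsum_fiberwise idx using 1
      ext i
      refine (HasSum.tsum_eq ?_).symm
      have K := hasSum_convAt μ ν h (V i)
      rw [← hasSum_subtype_iff_indicator] at K
      let e : (idx ⁻¹' {i}) ≃ {c : Balls p h × Balls p h | c.1 + c.2 ∈ V i} :=
        { toFun := fun c => ⟨c.1.1, by have := hidx c.1; rwa [show idx c.1 = i from c.2] at this⟩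
          invFun := fun c => ⟨⟨c.1, mem_iUnion.2 ⟨i, c.2⟩⟩, hdV (hidx _) c.2⟩
          left_inv := fun _ => rfl
          right_inv := fun _ => rfl }
      exact e.hasSum_iff.2 K }⟩

theorem mul_cyl (μ ν : UnifMeasure p) (h : ℕ) (V : Set (Balls p h)) :
    (μ * ν).toFun (cyl h V) = ∑' c : Balls p h × Balls p h,
      {c : Balls p h × Balls p h | c.1 + c.2 ∈ V}.indicator
        (fun c => μ.ball h c.1 * ν.ball h c.2) c :=
  convFun_eq μ ν h V

/-- The unit is the Dirac mass at the origin. -/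
instance : One (UnifMeasure p) := ⟨dirac 0⟩

theorem ext_cyl {μ ν : UnifMeasure p}
    (H : ∀ (h : ℕ) (V : Set (Balls p h)), μ.toFun (cyl h V) = ν.toFun (cyl h V)) : μ = ν := by
  refine UnifMeasure.ext (funext fun U => ?_)
  obtain ⟨U, hU⟩ := U
  obtain ⟨h, V, rfl⟩ := mem_iUnion.1 hU
  exact H h V

theorem hasSum_mul (μ ν : UnifMeasure p) (h : ℕ) (V : Set (Balls p h)) :
    HasSum ({c : Balls p h × Balls p h | c.1 + c.2 ∈ V}.indicator
      (fun c => μ.ball h c.1 * ν.ball h c.2)) ((μ * ν).toFun (cyl h V)) := by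
  rw [mul_cyl]
  exact hasSum_convAt μ ν h V

theorem mul_comm_aux (μ ν : UnifMeasure p) : μ * ν = ν * μ := by
  refine ext_cyl fun h V => ?_
  refine (hasSum_mul μ ν h V).unique ?_
  rw [← (Equiv.prodComm _ _).hasSum_iff]
  convert! hasSum_mul ν μ h V using 1
  ext ⟨c, d⟩
  classical
  simp [indicator_apply, add_comm, mul_comm]

theorem hasSum_mul_mul (μ ν ρ : UnifMeasure p) (h : ℕ) (V : Set (Balls p h)) :
    HasSum ({x : (Balls p h × Balls p h) × Balls p h | x.1.1 + x.1.2 + x.2 ∈ V}.indicator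
      (fun x => μ.ball h x.1.1 * ν.ball h x.1.2 * ρ.ball h x.2)) ((μ * ν * ρ).toFun (cyl h V)) := by
  have hs := (((μ.hasSum_ball h).mul_of_nonarchimedean (ν.hasSum_ball h)).mul_of_nonarchimedean
    (ρ.hasSum_ball h)).summable.indicator
      {x : (Balls p h × Balls p h) × Balls p h | x.1.1 + x.1.2 + x.2 ∈ V}
  have h1 := hs.hasSum.tsum_fiberwise (fun x => (x.1.1 + x.1.2, x.2))
  convert! hs.hasSum using 1
  refine (hasSum_mul (μ * ν) ρ h V).unique ?_
  convert! h1 using 1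
  ext ⟨c, d⟩
  rw [tsum_subtype]
  symm
  refine HasSum.tsum_eq ?_
  have h2 := hasSum_mul μ ν h {c}
  have h3 : HasSum (fun e : Balls p h => ({d} : Set (Balls p h)).indicator (ρ.ball h) e)
    (ρ.ball h d) := ρ.hasSum_cyl h {d}
  have h4 := h2.mul_of_nonarchimedean h3
  classical
  by_cases hV : c + d ∈ V
  · rw [indicator_of_mem (by exact hV)]
    convert! h4 using 1
    ext ⟨⟨a, b⟩, e⟩
    simp only [indicator_apply, mem_preimage, mem_singleton_iff, Prod.mk.injEq, mem_ofPred_eq]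
    by_cases e1 : a + b = c <;> by_cases e2 : e = d <;> simp [e1, e2, hV]
  · rw [indicator_of_notMem (by exact hV)]
    convert! hasSum_zero using 1
    ext ⟨⟨a, b⟩, e⟩
    simp only [indicator_apply, mem_preimage, mem_singleton_iff, Prod.mk.injEq, mem_ofPred_eq]
    by_cases e1 : a + b = c <;> by_cases e2 : e = d <;> simp [e1, e2, hV]

theorem mul_assoc_aux (μ ν ρ : UnifMeasure p) : μ * ν * ρ = μ * (ν * ρ) := by
  rw [mul_comm_aux μ (ν * ρ)]
  refine ext_cyl fun h V => ?_
  refine (hasSum_mul_mul μ ν ρ h V).unique ?_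
  let e : (Balls p h × Balls p h) × Balls p h ≃ (Balls p h × Balls p h) × Balls p h :=
    { toFun := fun x => ((x.1.2, x.2), x.1.1)
      invFun := fun x => ((x.2, x.1.1), x.1.2)
      left_inv := fun _ => rfl
      right_inv := fun _ => rfl }
  convert! e.hasSum_iff.2 (hasSum_mul_mul ν ρ μ h V) using 1
  ext ⟨⟨a, b⟩, c⟩
  classical
  have e1 : b + c + a = a + b + c := by abel
  have e2 : ν.ball h b * ρ.ball h c * μ.ball h a = μ.ball h a * ν.ball h b * ρ.ball h c := by ring
  simp only [indicator_apply, mem_ofPred_eq, Function.comp_apply, e, Equiv.coe_fn_mk, e1, e2]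

theorem one_ball (h : ℕ) (c : Balls p h) [Decidable (c = 0)] :
    (1 : UnifMeasure p).ball h c = if c = 0 then 1 else 0 := by
  classical
  change (if (0 : ℚ_[p]) ∈ proj p h ⁻¹' {c} then (1 : ℤ_[p]) else 0) = _
  have : (0 : ℚ_[p]) ∈ proj p h ⁻¹' {c} ↔ c = 0 := by
    rw [mem_preimage, mem_singleton_iff]
    exact eq_comm
  simp only [this]

theorem one_mul_aux (μ : UnifMeasure p) : 1 * μ = μ := by
  refine ext_cyl fun h V => ?_
  refine (hasSum_mul 1 μ h V).unique ?_
  have hinj : Function.Injective (fun d : Balls p h => ((0 : Balls p h), d)) := fun a b hab => by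
    simpa using hab
  classical
  rw [← hinj.hasSum_iff]
  · convert! μ.hasSum_cyl h V using 1
    ext d
    simp [indicator_apply, one_ball]
  · rintro ⟨c, d⟩ hcd
    have : c ≠ 0 := by
      rintro rfl
      exact hcd ⟨d, rfl⟩
    simp [indicator_apply, one_ball, this]

theorem add_mul_aux (μ ν ρ : UnifMeasure p) : (μ + ν) * ρ = μ * ρ + ν * ρ := by
  refine ext_cyl fun h V => ?_
  refine (hasSum_mul (μ + ν) ρ h V).unique ?_
  convert! (hasSum_mul μ ρ h V).add (hasSum_mul ν ρ h V) using 1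
  ext ⟨c, d⟩
  have : (μ + ν).ball h c = μ.ball h c + ν.ball h c := rfl
  classical
  simp only [indicator_apply, this]
  split_ifs <;> ring

theorem smul_mul_aux (a : ℤ_[p]) (μ ν : UnifMeasure p) : (a • μ) * ν = a • (μ * ν) := by
  refine ext_cyl fun h V => ?_
  refine (hasSum_mul (a • μ) ν h V).unique ?_
  convert! (hasSum_mul μ ν h V).mul_left a using 1
  ext ⟨c, d⟩
  have : (a • μ).ball h c = a * μ.ball h c := rfl
  classical
  simp only [indicator_apply, this]
  split_ifs <;> ring

instance : CommRing (UnifMeasure p) where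
  mul_assoc := mul_assoc_aux
  mul_comm := mul_comm_aux
  one_mul := one_mul_aux
  mul_one μ := by rw [mul_comm_aux, one_mul_aux]
  left_distrib μ ν ρ := by
    rw [mul_comm_aux, add_mul_aux, mul_comm_aux ν, mul_comm_aux ρ]
  right_distrib := add_mul_aux
  zero_mul μ := by
    have := add_mul_aux 0 0 μ
    rw [add_zero] at this
    exact left_eq_add.1 this
  mul_zero μ := by
    have := add_mul_aux 0 0 μ
    rw [add_zero] at this
    rw [mul_comm_aux]
    exact left_eq_add.1 this
  zsmul := fun n μ => n • μ
  zsmul_zero' := zero_zsmul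
  zsmul_succ' := fun n a => by exact SubNegMonoid.zsmul_succ' n a
  zsmul_neg' := fun n a => by exact SubNegMonoid.zsmul_neg' n a
  neg_add_cancel := neg_add_cancel
  sub_eq_add_neg := sub_eq_add_neg
  nsmul := fun n μ => n • μ
  nsmul_zero := zero_nsmul
  nsmul_succ := fun n a => by exact AddMonoid.nsmul_succ n a

instance : Algebra ℤ_[p] (UnifMeasure p) :=
  Algebra.ofModule smul_mul_aux (fun a μ ν => by
    rw [mul_comm, smul_mul_aux, mul_comm])

/-- The natural topology (and uniformity) on uniform measures: uniform convergence on the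
uniformly measurable sets of one and the same radius, for every radius. -/
instance : UniformSpace (UnifMeasure p) :=
  UniformSpace.comap
    (fun μ => UniformOnFun.ofFun (range fun h : ℕ => {U : unifSets p | U.1 ∈ unifSetsOfRadius p h})
      μ.toFun) inferInstance

end UnifMeasure

open UnifMeasure

variable (p)

/-- The measure `T_n = Δ_{1 / p ^ n} - Δ_0`. -/
def T (n : ℕ) : UnifMeasure p := dirac (1 / (p : ℚ_[p]) ^ n) - dirac 0

/-- The `p`-adic topology on the ring of uniform measures. -/
@[reducible]
def pAdicTopology : TopologicalSpace (UnifMeasure p) :=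
  (Ideal.span {(p : UnifMeasure p)}).adicTopology

/-- `T̃_n`, the limit of `T_{n + m} ^ (p ^ m)` for `m → ∞` in the `p`-adic topology. -/
def tT (n : ℕ) : UnifMeasure p :=
  @limUnder _ (pAdicTopology p) _ ⟨0⟩ atTop (fun m : ℕ => T p (n + m) ^ p ^ m)

/-- The monoid `S` of the real numbers in `ℤ[1 / p]` that are `≥ 0`. -/
def S : AddSubmonoid ℝ where
  carrier := {q | ∃ m n : ℕ, q = m / (p : ℝ) ^ n}
  zero_mem' := ⟨0, 0, by simp⟩
  add_mem' := by
    rintro _ _ ⟨m, n, rfl⟩ ⟨m', n', rfl⟩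
    have : (p : ℝ) ≠ 0 := by exact_mod_cast (Fact.out : p.Prime).ne_zero
    exact ⟨m * p ^ n' + m' * p ^ n, n + n', by push_cast; field_simp; ring⟩

variable {p}

/-- `T̃ ^ q` for `q = m / p ^ n` in `S`, that is, `T̃_n ^ m`. -/
def tPow (q : S p) : UnifMeasure p := tT p q.2.choose_spec.choose ^ q.2.choose

variable (p)

/-- The subring `ℤ[T̃ ^ (1 / p ^ ∞)]`, generated by the `T̃_n`. -/
def ZT : Subring (UnifMeasure p) := Subring.closure (range (tT p))

variable {p}

/-- The `p`-adic valuation of `ℤ_p`, with value `∞` at `0`. -/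
def vp (a : ℤ_[p]) : WithTop ℝ :=
  open Classical in if a = 0 then ⊤ else ((a.valuation : ℝ) : WithTop ℝ)

/-- `v(a) + q`, the weight of the term `a T̃ ^ q`. -/
def weight (a : ℤ_[p]) (q : S p) : WithTop ℝ := vp a + ((q : ℝ) : WithTop ℝ)

/-- For any `C > 0`, `v(a_q) + q > C` for almost all `q`. -/
def WeightsTendToTop (a : S p → ℤ_[p]) : Prop :=
  ∀ C : ℝ, 0 < C → ∀ᶠ q in cofinite, (C : WithTop ℝ) < weight (a q) q

/-- The uniform structure (and topology) on a ring that is induced by an additive valuation. -/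
@[reducible]
def valUniformSpace {A : Type} [CommRing A] (w : AddValuation A (WithTop ℝ)) : UniformSpace A :=
  (Valued.mk' (AddValuation.toValuation w)).toUniformSpace

/-- `i : A → B` exhibits the topological ring `B` as the completion of `A` for the valuation `w`:
`B` is separated and complete, `A` is dense in it and the uniformity of `B` induces that of `w`. -/
structure IsValuationCompletion {A B : Type} [CommRing A] [CommRing B] [UniformSpace B]
    (w : AddValuation A (WithTop ℝ)) (i : A →+* B) : Prop where
  isTopologicalRing : IsTopologicalRing B
  isUniformAddGroup : IsUniformAddGroup B
  completeSpace : CompleteSpace B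
  t2Space : T2Space B
  isUniformInducing : @IsUniformInducing A B (valUniformSpace w) _ i
  denseRange : DenseRange i

end PadicMeasures

end

open PadicMeasures

noncomputable section

open Filter Topology Set

namespace PadicMeasures

open UnifMeasure

variable {p : ℕ} [Fact p.Prime]

/-! Two filtrations of the ring of measures are compared: the ideals `nbhdIdeal p h l`, which define
the natural topology, and the groups `weightClosure p C`, the closures of the spans of the terms `a
T̃^q` with `v(a) + q ≥ C`, which are multiplicative in `C` by construction. The heart of the matter
is that each refines the other.

On the one hand, modulo `p` Frobenius turns `T̃^(p^h)` into `Δ_(p^h) - Δ_0`, which vanishes on the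
balls of radius `h`; hence terms of large weight are small (`smul_tPow_mem_nbhdIdeal`). On the other
hand, `Δ_(p^n)` is the limit of `(1 + T̃_m)^(p^(m+n))`, and the divisibility of binomial
coefficients by `p` gives every nonconstant term of the expansion weight at least `n`. So Dirac
masses at two points of one ball of radius `n` agree up to weight `n`. As measures are limits of
finite combinations of Dirac masses, `nbhdIdeal_le_weightClosure` follows, and successive
approximation turns it into expansions in `S`-series.

Uniqueness rests on `p_dvd_coeff_of_hasSum`: if the sum is divisible by `p`, so are all
coefficients. On balls of radius `h` and modulo `p`, only exponents `i / p^n < p^h` survive, and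
there the powers of `T_n` are independent because those of `1 + T_n = Δ_(1/p^n)` are Dirac masses in
distinct balls. Dividing by `p` and iterating kills every series with sum `0`.

The least weight is therefore a well-defined function `wFun`, and `C ≤ wFun μ` means `μ ∈
weightClosure p C`. Multiplicativity holds because in the product of two finite leading parts the
terms of smallest exponent cannot cancel, `S` being totally ordered. For the `(p, T̃)`-adic
topology, a series of weight at least `2n` is split at the exponent `n`: one part is divisible by
`p^n`, the other by `T̃^n`. -/

/-! ### Divisibility and infinite sums in `ℤ_p`. -/

theorem hasSum_mem_of_isClosed {ι G σ : Type*} [AddCommMonoid G] [TopologicalSpace G]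
    [SetLike σ G] [AddSubmonoidClass σ G] {s : σ} (hs : IsClosed (s : Set G)) {f : ι → G} {x : G}
    (hf : ∀ i, f i ∈ s) (h : HasSum f x) : x ∈ s :=
  hs.mem_of_tendsto h (Eventually.of_forall fun _ => sum_mem fun i _ => hf i)

theorem pow_dvd_iff_norm_le (x : ℤ_[p]) (n : ℕ) :
    (p : ℤ_[p]) ^ n ∣ x ↔ ‖x‖ ≤ (p : ℝ) ^ (-(n : ℤ)) := by
  rw [PadicInt.norm_le_pow_iff_mem_span_pow, Ideal.mem_span_singleton]

theorem isClosed_span_pow (n : ℕ) :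
    IsClosed ((Ideal.span {(p : ℤ_[p]) ^ n} : Ideal ℤ_[p]) : Set ℤ_[p]) := by
  have : ((Ideal.span {(p : ℤ_[p]) ^ n} : Ideal ℤ_[p]) : Set ℤ_[p]) =
      {x | ‖x‖ ≤ (p : ℝ) ^ (-(n : ℤ))} := by
    ext x
    exact (PadicInt.norm_le_pow_iff_mem_span_pow x n).symm
  rw [this]
  exact isClosed_le continuous_norm continuous_const

theorem pow_dvd_of_hasSum {ι : Type*} {f : ι → ℤ_[p]} {x : ℤ_[p]} {n : ℕ}
    (hf : ∀ i, (p : ℤ_[p]) ^ n ∣ f i) (h : HasSum f x) : (p : ℤ_[p]) ^ n ∣ x :=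
  Ideal.mem_span_singleton.1 <| hasSum_mem_of_isClosed (isClosed_span_pow n)
    (fun i => Ideal.mem_span_singleton.2 (hf i)) h

theorem padicInt_hasBasis_nhds_zero :
    (𝓝 (0 : ℤ_[p])).HasBasis (fun _ : ℕ => True) fun n => {x | (p : ℤ_[p]) ^ n ∣ x} := by
  have hp : 1 < p := (Fact.out : p.Prime).one_lt
  have h0 : (0 : ℝ) < (p : ℝ)⁻¹ := by positivity
  have h1 : (p : ℝ)⁻¹ < 1 := inv_lt_one_of_one_lt₀ (by exact_mod_cast hp)
  convert! Metric.nhds_basis_closedBall_pow (x := (0 : ℤ_[p])) h0 h1 using 2 with n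
  ext x
  simp [pow_dvd_iff_norm_le]

theorem eq_zero_of_forall_pow_dvd {x : ℤ_[p]} (h : ∀ n : ℕ, (p : ℤ_[p]) ^ n ∣ x) : x = 0 := by
  by_contra hx
  have := (PadicInt.mem_span_pow_iff_le_valuation x hx (x.valuation + 1)).1
    (Ideal.mem_span_singleton.2 (h _))
  omega

theorem padicInt_p_ne_zero : (p : ℤ_[p]) ≠ 0 := by
  exact_mod_cast (Fact.out : p.Prime).ne_zero

/-! ### The natural topology: a basis of ideals, separation, completeness. -/

theorem sub_ball (μ ν : UnifMeasure p) (h : ℕ) (c : Balls p h) :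
    (μ - ν).ball h c = μ.ball h c - ν.ball h c := rfl

theorem smul_ball (a : ℤ_[p]) (μ : UnifMeasure p) (h : ℕ) (c : Balls p h) :
    (a • μ).ball h c = a * μ.ball h c := rfl

theorem ball_transition (μ : UnifMeasure p) {h h' : ℕ} (hh : h ≤ h') (c : Balls p h) :
    μ.ball h c = μ.toFun (cyl h' (transition hh ⁻¹' {c})) := rfl

/-- The ideal of the measures whose values at the sets of radius `h` are divisible by `p ^ l`. -/
def nbhdIdeal (p : ℕ) [Fact p.Prime] (h l : ℕ) : Ideal (UnifMeasure p) where
  carrier := {μ | ∀ c : Balls p h, (p : ℤ_[p]) ^ l ∣ μ.ball h c}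
  zero_mem' _ := dvd_zero _
  add_mem' ha hb c := dvd_add (ha c) (hb c)
  smul_mem' ν μ hμ c := by
    -- A convolution has at a ball a sum of products of values at balls of the same radius, so the
    -- radius is not lost.
    refine pow_dvd_of_hasSum (fun d => ?_) (hasSum_mul ν μ h {c})
    classical
    rw [indicator_apply]
    split_ifs
    · exact (hμ d.2).mul_left _
    · exact dvd_zero _

theorem mem_nbhdIdeal_iff_cyl {h l : ℕ} {μ : UnifMeasure p} :
    μ ∈ nbhdIdeal p h l ↔ ∀ V : Set (Balls p h), (p : ℤ_[p]) ^ l ∣ μ.toFun (cyl h V) := by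
  refine ⟨fun H V => pow_dvd_of_hasSum (fun c => ?_) (μ.hasSum_cyl h V), fun H c => H _⟩
  classical
  rw [indicator_apply]
  split_ifs
  · exact H c
  · exact dvd_zero _

theorem nbhdIdeal_anti {h h' l l' : ℕ} (hh : h ≤ h') (hl : l ≤ l') :
    nbhdIdeal p h' l' ≤ nbhdIdeal p h l := fun μ hμ c => by
  rw [ball_transition μ hh]
  exact (pow_dvd_pow _ hl).trans (mem_nbhdIdeal_iff_cyl.1 hμ _)

theorem mul_mem_nbhdIdeal {h a b : ℕ} {μ ν : UnifMeasure p} (hμ : μ ∈ nbhdIdeal p h a)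
    (hν : ν ∈ nbhdIdeal p h b) : μ * ν ∈ nbhdIdeal p h (a + b) := fun c => by
  refine pow_dvd_of_hasSum (fun d => ?_) (hasSum_mul μ ν h {c})
  classical
  rw [indicator_apply, pow_add]
  split_ifs
  · exact mul_dvd_mul (hμ _) (hν _)
  · exact dvd_zero _

theorem pow_mem_nbhdIdeal {h a : ℕ} {μ : UnifMeasure p} (hμ : μ ∈ nbhdIdeal p h a) (k : ℕ) :
    μ ^ k ∈ nbhdIdeal p h (a * k) := by
  induction k with
  | zero => exact fun c => by simp
  | succ k ih => rw [pow_succ, mul_add, mul_one]; exact mul_mem_nbhdIdeal ih hμ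

theorem nbhdIdeal_zero (h : ℕ) : nbhdIdeal p h 0 = ⊤ :=
  (Ideal.eq_top_iff_one _).2 fun c => by simp

theorem eq_zero_of_forall_mem_nbhdIdeal {μ : UnifMeasure p} (H : ∀ n, μ ∈ nbhdIdeal p n n) :
    μ = 0 := by
  refine ext_cyl fun h V => eq_zero_of_forall_pow_dvd fun n => ?_
  exact mem_nbhdIdeal_iff_cyl.1 (nbhdIdeal_anti (le_max_left h n) (le_max_right h n) (H _)) V

/-- One index serves as radius and as precision, since enlarging either one shrinks the ideal. This
makes the uniformity countably generated, so that completeness can be tested on sequences. -/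
theorem hasBasis_uniformity : (uniformity (UnifMeasure p)).HasBasis (fun _ : ℕ => True)
    fun n => {x | x.2 - x.1 ∈ nbhdIdeal p n n} := by
  have hmono : ∀ {h h' : ℕ}, h ≤ h' → {U : unifSets p | U.1 ∈ unifSetsOfRadius p h} ⊆
      {U : unifSets p | U.1 ∈ unifSetsOfRadius p h'} := by
    rintro h h' hh ⟨U, hU⟩ ⟨V, rfl⟩
    exact ⟨transition hh ⁻¹' V, rfl⟩
  have hZ : (uniformity ℤ_[p]).HasBasis (fun _ : ℕ => True)
      fun n => {x | (p : ℤ_[p]) ^ n ∣ x.2 - x.1} := by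
    rw [uniformity_eq_comap_nhds_zero]
    exact padicInt_hasBasis_nhds_zero.comap _
  have hB := (UniformOnFun.hasBasis_uniformity_of_basis (unifSets p) ℤ_[p]
    (range fun h : ℕ => {U : unifSets p | U.1 ∈ unifSetsOfRadius p h}) ⟨_, 0, rfl⟩ (by
      rintro _ ⟨h, rfl⟩ _ ⟨h', rfl⟩
      exact ⟨_, ⟨max h h', rfl⟩, hmono (le_max_left _ _), hmono (le_max_right _ _)⟩) hZ).comap
    (Prod.map (fun μ : UnifMeasure p => UniformOnFun.ofFun _ μ.toFun)
      (fun μ : UnifMeasure p => UniformOnFun.ofFun _ μ.toFun))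
  refine HasBasis.to_hasBasis (l := uniformity (UnifMeasure p)) hB ?_ ?_
  · rintro ⟨_, l⟩ ⟨⟨h, rfl⟩, -⟩
    refine ⟨max h l, trivial, ?_⟩
    rintro ⟨μ, ν⟩ hμν ⟨U, hU⟩ ⟨V, rfl⟩
    exact mem_nbhdIdeal_iff_cyl.1
      (nbhdIdeal_anti (le_max_left h l) (le_max_right h l) hμν) V
  · rintro n -
    refine ⟨⟨_, n⟩, ⟨⟨n, rfl⟩, trivial⟩, ?_⟩
    rintro ⟨μ, ν⟩ hμν c
    exact hμν (cyl n {c}) ⟨{c}, rfl⟩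

/-- The additive homomorphism underlying the definition of the uniform structure. -/
def toUniformOnFunHom : UnifMeasure p →+ UniformOnFun (unifSets p) ℤ_[p]
    (range fun h : ℕ => {U : unifSets p | U.1 ∈ unifSetsOfRadius p h}) where
  toFun μ := UniformOnFun.ofFun _ μ.toFun
  map_zero' := rfl
  map_add' _ _ := rfl

instance : IsUniformAddGroup (UnifMeasure p) :=
  IsUniformAddGroup.comap (toUniformOnFunHom (p := p))

theorem hasBasis_nhds_zero : (𝓝 (0 : UnifMeasure p)).HasBasis (fun _ : ℕ => True)
    fun n => (nbhdIdeal p n n : Set (UnifMeasure p)) := by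
  convert! nhds_basis_uniformity hasBasis_uniformity (x := (0 : UnifMeasure p)) using 2 with n
  ext x
  simp

instance : IsTopologicalRing (UnifMeasure p) := by
  have key : ∀ x : UnifMeasure p, Tendsto (fun y => x * y) (𝓝 0) (𝓝 0) := fun x =>
    (hasBasis_nhds_zero.tendsto_iff hasBasis_nhds_zero).2 fun n _ =>
      ⟨n, trivial, fun y hy => Ideal.mul_mem_left _ _ hy⟩
  refine IsTopologicalRing.of_addGroup_of_nhds_zero ?_ key fun x => by
    simpa only [mul_comm] using key x
  refine ((hasBasis_nhds_zero.prod_self).tendsto_iff hasBasis_nhds_zero).2 fun n _ =>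
      ⟨n, trivial, fun y hy => Ideal.mul_mem_left _ _ hy.2⟩

theorem isOpen_nbhdIdeal (h l : ℕ) : IsOpen (nbhdIdeal p h l : Set (UnifMeasure p)) :=
  (nbhdIdeal p h l).toAddSubgroup.isOpen_of_mem_nhds (g := 0) <|
    mem_of_superset (hasBasis_nhds_zero.mem_of_mem (i := max h l) trivial)
      (nbhdIdeal_anti (le_max_left h l) (le_max_right h l))

theorem isClosed_nbhdIdeal (h l : ℕ) : IsClosed (nbhdIdeal p h l : Set (UnifMeasure p)) :=
  (nbhdIdeal p h l).toAddSubgroup.isClosed_of_isOpen (isOpen_nbhdIdeal h l)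

instance : NonarchimedeanAddGroup (UnifMeasure p) where
  is_nonarchimedean U hU := by
    obtain ⟨n, -, hn⟩ := hasBasis_nhds_zero.mem_iff.1 hU
    exact ⟨⟨(nbhdIdeal p n n).toAddSubgroup, isOpen_nbhdIdeal n n⟩, hn⟩

instance : T2Space (UnifMeasure p) := by
  refine IsTopologicalAddGroup.t2Space_of_zero_sep fun x hx => ?_
  by_contra! H
  exact hx (eq_zero_of_forall_mem_nbhdIdeal fun n => H _ (hasBasis_nhds_zero.mem_of_mem trivial))

theorem tendsto_iff_eventually_sub_mem {ι : Type*} {f : ι → UnifMeasure p} {l : Filter ι}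
    {μ : UnifMeasure p} :
    Tendsto f l (𝓝 μ) ↔ ∀ n, ∀ᶠ i in l, f i - μ ∈ nbhdIdeal p n n := by
  rw [← tendsto_sub_nhds_zero_iff, hasBasis_nhds_zero.tendsto_right_iff]
  simp

/-- A set function that agrees with measures to arbitrary precision on the sets of any given
radius is a measure. -/
theorem hasSum_iUnion_of_approx (f : unifSets p → ℤ_[p])
    (H : ∀ h l : ℕ, ∃ μ : UnifMeasure p, ∀ U : unifSets p, U.1 ∈ unifSetsOfRadius p h →
      (p : ℤ_[p]) ^ l ∣ f U - μ.toFun U) (h : ℕ) (ι : Type) (U : ι → Set ℚ_[p])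
    (hU : ∀ i, U i ∈ unifSetsOfRadius p h) (hd : Pairwise fun i j => Disjoint (U i) (U j)) :
    HasSum (fun i => f ⟨U i, mem_unifSets (hU i)⟩)
      (f ⟨⋃ i, U i, mem_unifSets (iUnion_mem hU)⟩) := by
  rw [HasSum, ← tendsto_sub_nhds_zero_iff, padicInt_hasBasis_nhds_zero.tendsto_right_iff]
  intro l _
  obtain ⟨μ, hμ⟩ := H h l
  have := μ.hasSum_iUnion h ι U hU hd
  rw [HasSum, ← tendsto_sub_nhds_zero_iff, padicInt_hasBasis_nhds_zero.tendsto_right_iff] at this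
  filter_upwards [this l trivial] with s hs
  have h1 : (p : ℤ_[p]) ^ l ∣ ∑ i ∈ s, (f ⟨U i, mem_unifSets (hU i)⟩
    - μ.toFun ⟨U i, mem_unifSets (hU i)⟩) := Finset.dvd_sum fun i _ => hμ _ (hU i)
  have h2 := hμ ⟨⋃ i, U i, mem_unifSets (iUnion_mem hU)⟩ (iUnion_mem hU)
  rw [Finset.sum_sub_distrib] at h1
  have h3 := dvd_sub (dvd_add h1 hs) h2
  convert! h3 using 1
  ring

instance : (uniformity (UnifMeasure p)).IsCountablyGenerated :=
  hasBasis_uniformity.isCountablyGenerated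

instance : CompleteSpace (UnifMeasure p) := by
  refine UniformSpace.complete_of_cauchySeq_tendsto fun u hu => ?_
  have hu' : ∀ n, ∃ N, ∀ i ≥ N, ∀ j ≥ N, u j - u i ∈ nbhdIdeal p n n := fun n => by
    obtain ⟨N, hN⟩ := (hasBasis_uniformity.cauchySeq_iff.1 hu) n trivial
    exact ⟨N, fun i hi j hj => hN i hi j hj⟩
  choose N hN using hu'
  have hval : ∀ (h l : ℕ) (U : unifSets p), U.1 ∈ unifSetsOfRadius p h →
      ∀ i ≥ N (max h l), ∀ j ≥ N (max h l), (p : ℤ_[p]) ^ l ∣ (u j).toFun U - (u i).toFun U := by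
    rintro h l ⟨U, hU⟩ ⟨V, rfl⟩ i hi j hj
    exact mem_nbhdIdeal_iff_cyl.1
      (nbhdIdeal_anti (le_max_left h l) (le_max_right h l) (hN _ i hi j hj)) V
  have hlim : ∀ U : unifSets p, ∃ x, Tendsto (fun i => (u i).toFun U) atTop (𝓝 x) := by
    intro U
    refine cauchySeq_tendsto_of_complete ?_
    obtain ⟨h, hh⟩ := mem_iUnion.1 U.2
    have hZ : (uniformity ℤ_[p]).HasBasis (fun _ : ℕ => True)
        fun n => {x | (p : ℤ_[p]) ^ n ∣ x.2 - x.1} := by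
      rw [uniformity_eq_comap_nhds_zero]
      exact padicInt_hasBasis_nhds_zero.comap _
    exact hZ.cauchySeq_iff.2 fun l _ => ⟨N (max h l), fun i hi j hj => hval h l U hh i hi j hj⟩
  choose f hf using hlim
  have hfu : ∀ (h l : ℕ) (U : unifSets p), U.1 ∈ unifSetsOfRadius p h →
      ∀ i ≥ N (max h l), (p : ℤ_[p]) ^ l ∣ f U - (u i).toFun U := fun h l U hU i hi => by
    have := (isClosed_span_pow (p := p) l).mem_of_tendsto ((hf U).sub_const ((u i).toFun U))
      ((eventually_ge_atTop (N (max h l))).mono fun j hj =>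
        Ideal.mem_span_singleton.2 (hval h l U hU i hi j hj))
    exact Ideal.mem_span_singleton.1 this
  -- The pointwise limit is uniform on sets of one radius, which is what makes it a measure again.
  refine ⟨⟨f, hasSum_iUnion_of_approx f fun h l => ⟨u (N (max h l)), fun U hU =>
    hfu h l U hU _ le_rfl⟩⟩, tendsto_iff_eventually_sub_mem.2 fun n => ?_⟩
  filter_upwards [eventually_ge_atTop (N (max n n))] with i hi c
  exact (dvd_sub_comm).1 (hfu n n (cyl n {c}) ⟨_, rfl⟩ i hi)

/-! ### Divisibility of measures by powers of `p`. -/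

theorem natCast_mul_eq_smul (n : ℕ) (μ : UnifMeasure p) :
    (n : UnifMeasure p) * μ = (n : ℤ_[p]) • μ := by
  rw [Nat.cast_smul_eq_nsmul, nsmul_eq_mul]

theorem p_pow_mul (n : ℕ) (μ : UnifMeasure p) :
    (p : UnifMeasure p) ^ n * μ = (p : ℤ_[p]) ^ n • μ := by
  have := natCast_mul_eq_smul (p ^ n) μ
  simpa using this

/-- The set function obtained by dividing the values by `p^n` is still a measure, as `ℤ_p` has no
`p`-torsion. This links the `p`-adic topology to the natural one: it asks for a precision that is
uniform in the radius. -/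
theorem p_pow_dvd_iff {n : ℕ} {μ : UnifMeasure p} :
    (p : UnifMeasure p) ^ n ∣ μ ↔ ∀ h, μ ∈ nbhdIdeal p h n := by
  constructor
  · rintro ⟨ν, rfl⟩ h c
    rw [p_pow_mul, smul_ball]
    exact dvd_mul_right _ _
  · intro H
    have hdvd : ∀ U : unifSets p, (p : ℤ_[p]) ^ n ∣ μ.toFun U := by
      rintro ⟨U, hU⟩
      obtain ⟨h, V, rfl⟩ := mem_iUnion.1 hU
      exact mem_nbhdIdeal_iff_cyl.1 (H h) V
    choose f hf using hdvd
    have hp : (p : ℤ_[p]) ^ n ≠ 0 := pow_ne_zero _ padicInt_p_ne_zero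
    refine ⟨⟨f, fun h ι U hU hd => ?_⟩, ?_⟩
    · have := μ.hasSum_iUnion h ι U hU hd
      simp only [hf] at this
      rw [HasSum, ← tendsto_sub_nhds_zero_iff, padicInt_hasBasis_nhds_zero.tendsto_right_iff]
        at this ⊢
      intro l _
      -- Precision `n + l` before the division leaves precision `l` after it.
      filter_upwards [this (n + l) trivial] with s hs
      rw [← Finset.mul_sum, ← mul_sub, pow_add] at hs
      exact (mul_dvd_mul_iff_left hp).1 hs
    · rw [p_pow_mul]
      exact UnifMeasure.ext (funext hf)

theorem eq_zero_of_p_mul_eq_zero {μ : UnifMeasure p} (h : (p : UnifMeasure p) * μ = 0) : μ = 0 := by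
  rw [natCast_mul_eq_smul] at h
  refine UnifMeasure.ext (funext fun U => ?_)
  have : (p : ℤ_[p]) * μ.toFun U = 0 := congrFun (congrArg UnifMeasure.toFun h) U
  exact (mul_eq_zero.1 this).resolve_left padicInt_p_ne_zero

theorem eq_zero_of_forall_p_pow_dvd {μ : UnifMeasure p}
    (h : ∀ n : ℕ, (p : UnifMeasure p) ^ n ∣ μ) : μ = 0 :=
  eq_zero_of_forall_mem_nbhdIdeal fun n => p_pow_dvd_iff.1 (h n) n

theorem smul_mem_nbhdIdeal {a : ℤ_[p]} {l : ℕ} (ha : (p : ℤ_[p]) ^ l ∣ a) (h : ℕ)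
    (μ : UnifMeasure p) : a • μ ∈ nbhdIdeal p h l := fun c => by
  rw [smul_ball]
  exact ha.mul_right _

theorem smul_mem_ideal (I : Ideal (UnifMeasure p)) (a : ℤ_[p]) {μ : UnifMeasure p} (hμ : μ ∈ I) :
    a • μ ∈ I := by
  rw [Algebra.smul_def]
  exact I.mul_mem_left _ hμ

theorem continuous_smul_const (μ : UnifMeasure p) : Continuous fun a : ℤ_[p] => a • μ := by
  refine continuous_of_continuousAt_zero (LinearMap.toSpanSingleton ℤ_[p] _ μ) ?_
  rw [ContinuousAt, map_zero]
  exact (padicInt_hasBasis_nhds_zero.tendsto_iff hasBasis_nhds_zero).2 fun n _ =>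
    ⟨n, trivial, fun a ha => smul_mem_nbhdIdeal ha n μ⟩

/-! ### Dirac masses. -/

theorem dirac_cyl (x : ℚ_[p]) (h : ℕ) (V : Set (Balls p h)) [Decidable (proj p h x ∈ V)] :
    (dirac x).toFun (cyl h V) = if proj p h x ∈ V then 1 else 0 := by
  simp only [dirac, cyl, mem_preimage]

theorem dirac_ball (x : ℚ_[p]) (h : ℕ) (c : Balls p h) [Decidable (proj p h x = c)] :
    (dirac x).ball h c = if proj p h x = c then 1 else 0 := by
  classical
  rw [UnifMeasure.ball, dirac_cyl]
  congr 1

theorem dirac_zero : dirac (0 : ℚ_[p]) = 1 := rfl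

theorem dirac_mul (x y : ℚ_[p]) : dirac x * dirac y = dirac (x + y) := by
  classical
  refine ext_cyl fun h V => (hasSum_mul (dirac x) (dirac y) h V).unique ?_
  have hs := hasSum_single (f := {c : Balls p h × Balls p h | c.1 + c.2 ∈ V}.indicator
    fun c => (dirac x).ball h c.1 * (dirac y).ball h c.2) (proj p h x, proj p h y) fun c hc => ?_
  · convert! hs using 1
    simp only [dirac_cyl, dirac_ball, indicator_apply, mem_ofPred_eq, if_true, mul_one]
    rfl
  · rw [indicator_apply, dirac_ball, dirac_ball]
    split_ifs with h1 h2 h3 <;> simp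
    exact hc (Prod.ext h2.symm h3.symm)

theorem dirac_pow (x : ℚ_[p]) (n : ℕ) : dirac x ^ n = dirac ((n : ℚ_[p]) * x) := by
  induction n with
  | zero => simp [dirac_zero]
  | succ n ih => rw [pow_succ, ih, dirac_mul]; push_cast; ring_nf

theorem dirac_sub_dirac_mem {x y : ℚ_[p]} {h : ℕ} (hxy : proj p h x = proj p h y) (l : ℕ) :
    dirac x - dirac y ∈ nbhdIdeal p h l := fun c => by
  classical
  simp [sub_ball, dirac_ball, hxy]

theorem padic_p_ne_zero : (p : ℚ_[p]) ≠ 0 := by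
  exact_mod_cast (Fact.out : p.Prime).ne_zero

/-! ### The limits `T̃_n`. -/

theorem dirac_eq_one_add_T (n : ℕ) : dirac (1 / (p : ℚ_[p]) ^ n) = 1 + T p n := by
  rw [T, dirac_zero]; ring

theorem dirac_p_pow_pow (n m : ℕ) :
    dirac (1 / (p : ℚ_[p]) ^ (n + m)) ^ p ^ m = dirac (1 / (p : ℚ_[p]) ^ n) := by
  have := padic_p_ne_zero (p := p)
  rw [dirac_pow]
  congr 1
  push_cast
  field_simp
  ring

/-- Frobenius modulo `p` applied to `(1 + T_(n+1))^p = 1 + T_n`. -/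
theorem p_dvd_T_succ_pow_sub (n : ℕ) : (p : UnifMeasure p) ∣ T p (n + 1) ^ p - T p n := by
  obtain ⟨r, hr⟩ := exists_add_pow_prime_eq (Fact.out : p.Prime) (T p (n + 1)) 1
  have h1 := dirac_p_pow_pow (p := p) n 1
  rw [pow_one, dirac_eq_one_add_T, dirac_eq_one_add_T, add_comm 1 (T p (n + 1)), hr] at h1
  refine ⟨-(T p (n + 1) * 1 * r), ?_⟩
  rw [one_pow] at h1
  linear_combination h1

/-- A congruence modulo `p` becomes one modulo `p^(j+1)` after raising to the power `p^j`; the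
successive congruences telescope. -/
theorem p_pow_dvd_T_pow_sub (n m k : ℕ) :
    (p : UnifMeasure p) ^ (m + 1) ∣ T p (n + (m + k)) ^ p ^ (m + k) - T p (n + m) ^ p ^ m := by
  induction k with
  | zero => simp
  | succ k ih =>
    have h := dvd_sub_pow_of_dvd_sub (p_dvd_T_succ_pow_sub (p := p) (n + (m + k))) (m + k)
    rw [← pow_mul, ← pow_succ'] at h
    have h' := (pow_dvd_pow (p : UnifMeasure p) (by omega : m + 1 ≤ m + k + 1)).trans h
    have := dvd_add h' ih
    rw [sub_add_sub_cancel] at this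
    exact this

theorem exists_p_pow_dvd_T_pow_sub (n : ℕ) :
    ∃ x : UnifMeasure p, ∀ m, (p : UnifMeasure p) ^ (m + 1) ∣ T p (n + m) ^ p ^ m - x := by
  have hc : CauchySeq fun m => T p (n + m) ^ p ^ m := by
    refine hasBasis_uniformity.cauchySeq_iff'.2 fun k _ => ⟨k, fun m hm => ?_⟩
    obtain ⟨j, rfl⟩ := Nat.exists_eq_add_of_le hm
    have := p_pow_dvd_iff.1 (p_pow_dvd_T_pow_sub (p := p) n k j) k
    have := nbhdIdeal_anti le_rfl (Nat.le_succ k) this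
    change _ ∈ nbhdIdeal p k k
    rw [← neg_mem_iff, neg_sub]
    exact this
  obtain ⟨x, hx⟩ := cauchySeq_tendsto_of_complete hc
  refine ⟨x, fun m => p_pow_dvd_iff.2 fun h => ?_⟩
  -- The limit exists in the complete natural topology; closedness of the ideals of every radius
  -- preserves the precision `m + 1` and makes it a `p`-adic limit.
  refine (isClosed_nbhdIdeal h (m + 1)).mem_of_tendsto (hx.const_sub (T p (n + m) ^ p ^ m)) ?_
  filter_upwards [eventually_ge_atTop m] with i hi
  obtain ⟨j, rfl⟩ := Nat.exists_eq_add_of_le hi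
  exact (dvd_sub_comm.1 (p_pow_dvd_T_pow_sub (p := p) n m j) |> p_pow_dvd_iff.1) h

theorem pAdic_tendsto_iff {f : ℕ → UnifMeasure p} {x : UnifMeasure p} :
    Tendsto f atTop (@nhds _ (pAdicTopology p) x) ↔
      ∀ k : ℕ, ∀ᶠ m in atTop, (p : UnifMeasure p) ^ k ∣ f m - x := by
  rw [((Ideal.span {(p : UnifMeasure p)}).hasBasis_nhds_adic x).tendsto_right_iff]
  refine ⟨fun H k => (H k trivial).mono fun m hm => ?_, fun H k _ => (H k).mono fun m hm => ?_⟩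
  · obtain ⟨y, hy, hxy⟩ := hm
    rw [Ideal.span_singleton_pow, SetLike.mem_coe, Ideal.mem_span_singleton] at hy
    rw [← hxy]
    simpa using hy
  · refine ⟨f m - x, ?_, by simp⟩
    rw [Ideal.span_singleton_pow, SetLike.mem_coe, Ideal.mem_span_singleton]
    exact hm

theorem tendsto_tT (n : ℕ) : Tendsto (fun m : ℕ => T p (n + m) ^ p ^ m) atTop
    (@nhds _ (pAdicTopology p) (tT p n)) := by
  obtain ⟨x, hx⟩ := exists_p_pow_dvd_T_pow_sub (p := p) n
  refine @tendsto_nhds_limUnder _ _ (pAdicTopology p) _ _ ⟨x, pAdic_tendsto_iff.2 fun k => ?_⟩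
  filter_upwards [eventually_ge_atTop k] with m hm
  exact (pow_dvd_pow _ (by omega)).trans (hx m)

theorem p_pow_dvd_T_pow_sub_tT (n m : ℕ) :
    (p : UnifMeasure p) ^ (m + 1) ∣ T p (n + m) ^ p ^ m - tT p n := by
  obtain ⟨i, hi, him⟩ := ((pAdic_tendsto_iff.1 (tendsto_tT (p := p) n) (m + 1)).and
    (eventually_ge_atTop m)).exists
  obtain ⟨j, rfl⟩ := Nat.exists_eq_add_of_le him
  have := dvd_sub hi (p_pow_dvd_T_pow_sub (p := p) n m j)
  rwa [sub_sub_sub_cancel_left] at this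

theorem p_dvd_tT_sub_T (n : ℕ) : (p : UnifMeasure p) ∣ tT p n - T p n := by
  simpa using dvd_sub_comm.1 (p_pow_dvd_T_pow_sub_tT (p := p) n 0)

/-- Both sides are congruent to powers of `T_(n+m+1)` modulo growing powers of `p`, and no nonzero
measure is divisible by all of these. This is what makes `T̃^q` independent of the fraction chosen
for `q`. -/
theorem tT_succ_pow (n : ℕ) : tT p (n + 1) ^ p = tT p n := by
  refine sub_eq_zero.1 (eq_zero_of_forall_p_pow_dvd fun m => ?_)
  have h1 := dvd_sub_pow_of_dvd_sub (p_dvd_T_succ_pow_sub (p := p) (n + m)) m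
  rw [← pow_mul, ← pow_succ'] at h1
  have h2 : (p : UnifMeasure p) ^ (m + 1) ∣ T p (n + m + 1) ^ p ^ (m + 1) - tT p (n + 1) ^ p := by
    have := (p_pow_dvd_T_pow_sub_tT (p := p) (n + 1) m).trans (sub_dvd_pow_sub_pow _ _ p)
    rw [← pow_mul, ← pow_succ, add_right_comm] at this
    exact this
  have h3 := p_pow_dvd_T_pow_sub_tT (p := p) n m
  have := dvd_sub (dvd_add h1 h3) h2
  refine (pow_dvd_pow _ (Nat.le_succ m)).trans ?_
  convert! this using 1
  ring

theorem tT_add_pow (n k : ℕ) : tT p (n + k) ^ p ^ k = tT p n := by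
  induction k with
  | zero => simp
  | succ k ih => rw [pow_succ', pow_mul, ← add_assoc, tT_succ_pow, ih]

/-! ### The monoid `S` and the powers `T̃^q`. -/

theorem real_p_pos : (0 : ℝ) < p := by exact_mod_cast (Fact.out : p.Prime).pos

theorem tPow_eq (m n : ℕ) (q : S p) (hq : (q : ℝ) = m / (p : ℝ) ^ n) : tPow q = tT p n ^ m := by
  have hspec := q.2.choose_spec.choose_spec
  unfold tPow
  generalize q.2.choose_spec.choose = n' at *
  generalize q.2.choose = m' at *
  have hp := real_p_pos (p := p)
  have h : m' * p ^ n = m * p ^ n' := by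
    rw [hq] at hspec
    field_simp at hspec
    rw [mul_comm]
    exact_mod_cast hspec.symm
  rw [← tT_add_pow n' n, ← tT_add_pow n n', ← pow_mul, ← pow_mul, add_comm n' n, mul_comm, h,
    mul_comm]

/-- The element `i / p ^ n` of `S`. -/
def sFrac (p : ℕ) [Fact p.Prime] (n i : ℕ) : S p := ⟨i / (p : ℝ) ^ n, i, n, rfl⟩

theorem coe_sFrac (n i : ℕ) : (sFrac p n i : ℝ) = i / (p : ℝ) ^ n := rfl

theorem tPow_sFrac (n i : ℕ) : tPow (sFrac p n i) = tT p n ^ i := tPow_eq i n _ rfl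

theorem sFrac_injective (n : ℕ) : Function.Injective (sFrac p n) := fun i j hij => by
  have hp := real_p_pos (p := p)
  have := congrArg (Subtype.val : S p → ℝ) hij
  rw [coe_sFrac, coe_sFrac] at this
  field_simp at this
  exact_mod_cast this

/-- Stated with a filter so that finitely many elements get a common denominator by intersecting. -/
theorem eventually_exists_eq_sFrac (q : S p) : ∀ᶠ n in atTop, ∃ i, q = sFrac p n i := by
  obtain ⟨q, m, n, rfl⟩ := q
  filter_upwards [eventually_ge_atTop n] with k hk
  obtain ⟨j, rfl⟩ := Nat.exists_eq_add_of_le hk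
  have hp := real_p_pos (p := p)
  refine ⟨m * p ^ j, Subtype.ext ?_⟩
  rw [coe_sFrac]
  push_cast
  rw [pow_add]
  field_simp

theorem tPow_zero : tPow (0 : S p) = 1 := by
  rw [tPow_eq 0 0 _ (by simp), pow_zero]

theorem tPow_add (q r : S p) : tPow (q + r) = tPow q * tPow r := by
  obtain ⟨n, ⟨i, rfl⟩, j, rfl⟩ :=
    ((eventually_exists_eq_sFrac q).and (eventually_exists_eq_sFrac r)).exists
  rw [tPow_sFrac, tPow_sFrac, ← pow_add]
  refine tPow_eq _ n _ ?_
  rw [AddSubmonoid.coe_add, coe_sFrac, coe_sFrac]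
  push_cast
  ring

theorem S_nonneg (q : S p) : (0 : ℝ) ≤ q := by
  obtain ⟨q, m, n, rfl⟩ := q
  positivity

theorem exists_add_eq {q r : S p} (h : (r : ℝ) ≤ q) : ∃ s : S p, r + s = q := by
  obtain ⟨n, ⟨i, rfl⟩, j, rfl⟩ :=
    ((eventually_exists_eq_sFrac q).and (eventually_exists_eq_sFrac r)).exists
  have hp := real_p_pos (p := p)
  rw [coe_sFrac, coe_sFrac, div_le_div_iff_of_pos_right (by positivity)] at h
  obtain ⟨k, rfl⟩ := Nat.exists_eq_add_of_le (by exact_mod_cast h : j ≤ i)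
  refine ⟨sFrac p n k, Subtype.ext ?_⟩
  rw [AddSubmonoid.coe_add, coe_sFrac, coe_sFrac, coe_sFrac]
  push_cast
  ring

/-! ### Smallness of `T̃^q` for large `q`. -/

theorem proj_eq_zero_iff {h : ℕ} {x : ℚ_[p]} :
    proj p h x = 0 ↔ ‖x‖ ≤ (p : ℝ) ^ (-(h : ℤ)) :=
  QuotientAddGroup.eq_zero_iff x

theorem proj_eq_iff {h : ℕ} {x y : ℚ_[p]} :
    proj p h x = proj p h y ↔ ‖x - y‖ ≤ (p : ℝ) ^ (-(h : ℤ)) := by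
  rw [← proj_eq_zero_iff, ← sub_eq_zero]
  rfl

/-- Modulo `p`, `T̃^(p^h) ≡ T_0^(p^h) ≡ Δ_(p^h) - Δ_0`, and the points `p^h` and `0` lie in the same
ball of radius `h`. -/
theorem tT_pow_mem_nbhdIdeal {h q : ℕ} (hq : p ^ h ≤ q) : tT p 0 ^ q ∈ nbhdIdeal p h 1 := by
  suffices H : tT p 0 ^ p ^ h ∈ nbhdIdeal p h 1 by
    obtain ⟨j, rfl⟩ := Nat.exists_eq_add_of_le hq
    rw [pow_add]
    exact Ideal.mul_mem_right _ _ H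
  have h1 : (p : UnifMeasure p) ∣ T p 0 ^ p ^ h - (dirac ((p : ℚ_[p]) ^ h) - 1) := by
    obtain ⟨r, hr⟩ := exists_add_pow_prime_pow_eq (Fact.out : p.Prime) (T p 0) 1 h
    have : (T p 0 + 1) ^ p ^ h = dirac ((p : ℚ_[p]) ^ h) := by
      rw [add_comm, ← dirac_eq_one_add_T, dirac_pow]
      simp
    rw [this, one_pow] at hr
    exact ⟨-(T p 0 * 1 * r), by rw [hr]; ring⟩
  have h2 : (p : UnifMeasure p) ∣ tT p 0 ^ p ^ h - T p 0 ^ p ^ h :=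
    (p_dvd_tT_sub_T 0).trans (sub_dvd_pow_sub_pow _ _ _)
  have h3 := dvd_add h2 h1
  have h4 : dirac ((p : ℚ_[p]) ^ h) - 1 ∈ nbhdIdeal p h 1 := by
    refine dirac_sub_dirac_mem (y := 0) ?_ 1
    rw [proj_eq_iff]
    simp
  rw [← pow_one (p : UnifMeasure p)] at h3
  have := add_mem (p_pow_dvd_iff.1 h3 h) h4
  convert! this using 1
  ring

theorem tPow_mem_nbhdIdeal {h l : ℕ} {q : S p} (hq : (l * p ^ h : ℝ) ≤ q) :
    tPow q ∈ nbhdIdeal p h l := by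
  obtain ⟨s, rfl⟩ := exists_add_eq (r := sFrac p 0 (p ^ h * l)) (q := q) (by
    rw [coe_sFrac]; push_cast; simpa [mul_comm] using hq)
  rw [tPow_add, tPow_sFrac, pow_mul]
  refine Ideal.mul_mem_right _ _ ?_
  simpa using pow_mem_nbhdIdeal (tT_pow_mem_nbhdIdeal (p := p) (le_refl (p ^ h))) l

/-! ### Weights. -/

theorem vp_of_ne_zero {a : ℤ_[p]} (ha : a ≠ 0) : vp a = ((a.valuation : ℝ) : WithTop ℝ) := by
  simp [vp, ha]

@[simp]
theorem vp_zero : vp (0 : ℤ_[p]) = ⊤ := by simp [vp]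

theorem le_vp_iff {C : ℝ} {a : ℤ_[p]} : (C : WithTop ℝ) ≤ vp a ↔ (p : ℤ_[p]) ^ ⌈C⌉₊ ∣ a := by
  by_cases ha : a = 0
  · simp [ha]
  · rw [vp_of_ne_zero ha, WithTop.coe_le_coe, ← Nat.ceil_le, ← Ideal.mem_span_singleton,
      PadicInt.mem_span_pow_iff_le_valuation a ha]

theorem vp_mul (a b : ℤ_[p]) : vp (a * b) = vp a + vp b := by
  by_cases ha : a = 0
  · simp [ha]
  by_cases hb : b = 0
  · simp [hb]
  rw [vp_of_ne_zero ha, vp_of_ne_zero hb, vp_of_ne_zero (mul_ne_zero ha hb),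
    PadicInt.valuation_mul ha hb, ← WithTop.coe_add]
  push_cast
  rfl

theorem weight_mul (a b : ℤ_[p]) (q r : S p) :
    weight (a * b) (q + r) = weight a q + weight b r := by
  rw [weight, weight, weight, vp_mul, AddSubmonoid.coe_add, WithTop.coe_add]
  abel

@[simp]
theorem weight_zero (q : S p) : weight 0 q = ⊤ := by simp [weight]

theorem weight_of_ne_zero {a : ℤ_[p]} (ha : a ≠ 0) (q : S p) :
    weight a q = ((a.valuation + q : ℝ) : WithTop ℝ) := by
  rw [weight, vp_of_ne_zero ha, WithTop.coe_add]

/-- Valuations are integers, hence the ceiling; it is `0` when `C ≤ q`, where the condition on `a`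
is void. -/
theorem le_weight_iff {C : ℝ} {a : ℤ_[p]} {q : S p} :
    (C : WithTop ℝ) ≤ weight a q ↔ (p : ℤ_[p]) ^ ⌈C - q⌉₊ ∣ a := by
  rw [← le_vp_iff, weight]
  cases vp a with
  | top => simp
  | coe v => rw [← WithTop.coe_add, WithTop.coe_le_coe, WithTop.coe_le_coe, sub_le_iff_le_add]

theorem le_weight_add {C : ℝ} {a b : ℤ_[p]} {q : S p} (ha : (C : WithTop ℝ) ≤ weight a q)
    (hb : (C : WithTop ℝ) ≤ weight b q) : (C : WithTop ℝ) ≤ weight (a + b) q :=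
  le_weight_iff.2 (dvd_add (le_weight_iff.1 ha) (le_weight_iff.1 hb))

theorem le_weight_neg {C : ℝ} {a : ℤ_[p]} {q : S p} (ha : (C : WithTop ℝ) ≤ weight a q) :
    (C : WithTop ℝ) ≤ weight (-a) q :=
  le_weight_iff.2 ((le_weight_iff.1 ha).neg_right)

theorem zero_le_weight (a : ℤ_[p]) (q : S p) : ((0 : ℝ) : WithTop ℝ) ≤ weight a q :=
  le_weight_iff.2 (by rw [Nat.ceil_eq_zero.2 (by linarith [S_nonneg q]), pow_zero]; exact one_dvd _)

/-- Either the exponent is at least `l p^h`, so that `T̃^q` itself is small, or the valuation of `a`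
is at least `l`. -/
theorem smul_tPow_mem_nbhdIdeal {h l : ℕ} {a : ℤ_[p]} {q : S p}
    (H : ((l * p ^ h + l : ℝ) : WithTop ℝ) ≤ weight a q) : a • tPow q ∈ nbhdIdeal p h l := by
  by_cases hq : (l * p ^ h : ℝ) ≤ q
  · exact smul_mem_ideal _ a (tPow_mem_nbhdIdeal hq)
  · refine smul_mem_nbhdIdeal ((pow_dvd_pow _ ?_).trans (le_weight_iff.1 H)) h _
    have : (l : ℝ) ≤ ⌈(l * p ^ h + l : ℝ) - q⌉₊ := le_trans (by linarith) (Nat.le_ceil _)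
    exact_mod_cast this

/-! ### The filtration by weight. -/

/-- The finite sums of terms `a T̃ ^ q` of weight at least `C`. -/
def finiteSums (p : ℕ) [Fact p.Prime] (C : ℝ) : AddSubgroup (UnifMeasure p) :=
  AddSubgroup.closure {x | ∃ (a : ℤ_[p]) (q : S p), (C : WithTop ℝ) ≤ weight a q ∧ a • tPow q = x}

/-- The closure of the finite sums of terms `a T̃ ^ q` of weight at least `C`. -/
def weightClosure (p : ℕ) [Fact p.Prime] (C : ℝ) : AddSubgroup (UnifMeasure p) :=
  (finiteSums p C).topologicalClosure

theorem smul_tPow_mem_finiteSums {C : ℝ} {a : ℤ_[p]} {q : S p}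
    (h : (C : WithTop ℝ) ≤ weight a q) : a • tPow q ∈ finiteSums p C :=
  AddSubgroup.subset_closure ⟨a, q, h, rfl⟩

theorem finiteSums_le_weightClosure (C : ℝ) : finiteSums p C ≤ weightClosure p C :=
  AddSubgroup.le_topologicalClosure _

theorem isClosed_weightClosure (C : ℝ) : IsClosed (weightClosure p C : Set (UnifMeasure p)) :=
  AddSubgroup.isClosed_topologicalClosure _

theorem mul_mem_finiteSums {C C' : ℝ} {x y : UnifMeasure p} (hx : x ∈ finiteSums p C)
    (hy : y ∈ finiteSums p C') : x * y ∈ finiteSums p (C + C') := by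
  induction hx using AddSubgroup.closure_induction with
  | mem x hx =>
    obtain ⟨a, q, ha, rfl⟩ := hx
    induction hy using AddSubgroup.closure_induction with
    | mem y hy =>
      obtain ⟨b, r, hb, rfl⟩ := hy
      rw [smul_mul_smul_comm, ← tPow_add]
      refine smul_tPow_mem_finiteSums ?_
      rw [weight_mul, WithTop.coe_add]
      exact add_le_add ha hb
    | zero => rw [mul_zero]; exact zero_mem _
    | add y z _ _ hy hz => rw [mul_add]; exact add_mem hy hz
    | neg y _ hy => rw [mul_neg]; exact neg_mem hy
  | zero => rw [zero_mul]; exact zero_mem _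
  | add x z _ _ hx hz => rw [add_mul]; exact add_mem hx hz
  | neg x _ hx => rw [neg_mul]; exact neg_mem hx

theorem mul_mem_weightClosure {C C' : ℝ} {x y : UnifMeasure p} (hx : x ∈ weightClosure p C)
    (hy : y ∈ weightClosure p C') : x * y ∈ weightClosure p (C + C') :=
  map_mem_closure₂ continuous_mul hx hy fun _ ha _ hb => mul_mem_finiteSums ha hb

theorem mem_of_forall_exists_sub_mem {H : AddSubgroup (UnifMeasure p)}
    (hH : IsClosed (H : Set (UnifMeasure p))) {x : UnifMeasure p}
    (h : ∀ n, ∃ y ∈ H, x - y ∈ nbhdIdeal p n n) : x ∈ H := by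
  choose y hy hxy using h
  refine hH.mem_of_tendsto (f := y) (b := atTop) ?_ (Eventually.of_forall hy)
  refine tendsto_iff_eventually_sub_mem.2 fun n => ?_
  filter_upwards [eventually_ge_atTop n] with m hm
  rw [← neg_mem_iff, neg_sub]
  exact nbhdIdeal_anti hm hm (hxy m)

theorem exists_finiteSums_sub_mem {C : ℝ} {x : UnifMeasure p} (hx : x ∈ weightClosure p C)
    (n : ℕ) : ∃ y ∈ finiteSums p C, x - y ∈ nbhdIdeal p n n := by
  have hn : (fun y => x - y) ⁻¹' (nbhdIdeal p n n : Set (UnifMeasure p)) ∈ 𝓝 x := by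
    refine (continuous_const.sub continuous_id).continuousAt.preimage_mem_nhds ?_
    simpa using hasBasis_nhds_zero.mem_of_mem (i := n) trivial
  obtain ⟨y, hy, hyC⟩ := mem_closure_iff_nhds.1 hx _ hn
  exact ⟨y, hyC, hy⟩

theorem tPow_mem_finiteSums_zero (q : S p) : tPow q ∈ finiteSums p 0 := by
  rw [← one_smul ℤ_[p] (tPow q)]
  exact smul_tPow_mem_finiteSums (zero_le_weight _ _)

/-! ### Dirac masses in the filtration by weight. -/

theorem one_add_tT_pow_mem (m k : ℕ) : (1 + tT p m) ^ k ∈ finiteSums p 0 := by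
  have h1 : (1 : UnifMeasure p) ∈ finiteSums p 0 := by
    rw [← tPow_zero]
    exact tPow_mem_finiteSums_zero _
  have hT : tT p m ∈ finiteSums p 0 := by
    rw [← pow_one (tT p m), ← tPow_sFrac]
    exact tPow_mem_finiteSums_zero _
  induction k with
  | zero => simpa using h1
  | succ k ih => rw [pow_succ]; simpa using mul_mem_finiteSums ih (add_mem h1 hT)

/-- From `i * choose (p^k) i = p^k * choose (p^k - 1) (i - 1)` with `i = p^s j`. -/
theorem pow_dvd_choose_prime_pow {p : ℕ} (hp : p.Prime) {k s j : ℕ} (hj : ¬p ∣ j) :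
    p ^ (k - s) ∣ (p ^ k).choose (p ^ s * j) := by
  rcases le_total k s with h | h
  · simp [Nat.sub_eq_zero_of_le h]
  have hj0 : j ≠ 0 := fun h => hj (h ▸ dvd_zero _)
  obtain ⟨i, hi⟩ := Nat.exists_eq_succ_of_ne_zero (mul_ne_zero (pow_ne_zero s hp.ne_zero) hj0)
  obtain ⟨n, hn⟩ := Nat.exists_eq_succ_of_ne_zero (pow_ne_zero k hp.ne_zero)
  have h1 := Nat.add_one_mul_choose_eq n i
  rw [← Nat.succ_eq_add_one, ← Nat.succ_eq_add_one, ← hn, ← hi] at h1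
  have h2 : p ^ s * p ^ (k - s) ∣ p ^ s * (j * (p ^ k).choose (p ^ s * j)) := by
    rw [← pow_add, Nat.add_sub_cancel' h]
    exact ⟨_, by rw [h1]; ring⟩
  have h3 := (mul_dvd_mul_iff_left (pow_ne_zero s hp.ne_zero)).1 h2
  exact (Nat.Coprime.pow_left _ ((Nat.Prime.coprime_iff_not_dvd hp).2 hj)).dvd_of_dvd_mul_left h3

theorem le_weight_choose (m n : ℕ) {i : ℕ} (hi : i ≠ 0) :
    ((n : ℝ) : WithTop ℝ) ≤ weight (((p ^ (m + n)).choose i : ℕ) : ℤ_[p]) (sFrac p m i) := by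
  have hp : p.Prime := Fact.out
  obtain ⟨s, j, hj, rfl⟩ := Nat.exists_eq_pow_mul_and_not_dvd hi p hp.ne_one
  have h1 : ((p ^ (m + n - s) : ℕ) : ℤ_[p]) ∣ ((p ^ (m + n)).choose (p ^ s * j) : ℕ) :=
    Nat.cast_dvd_cast (pow_dvd_choose_prime_pow hp hj)
  refine le_weight_iff.2 ((pow_dvd_pow _ ?_).trans (by simpa using h1))
  rw [Nat.ceil_le, coe_sFrac]
  have hp0 := real_p_pos (p := p)
  have h2 : (m + n : ℝ) - s ≤ ((m + n - s : ℕ) : ℝ) := by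
    have : m + n ≤ m + n - s + s := by omega
    have : ((m + n : ℕ) : ℝ) ≤ ((m + n - s + s : ℕ) : ℝ) := by exact_mod_cast this
    push_cast at this
    linarith
  have hj1 : 1 ≤ j := Nat.one_le_iff_ne_zero.2 fun h => hj (h ▸ dvd_zero _)
  -- The binomial coefficient has valuation at least `m + n - s`; the exponent `p^(s-m) j ≥ s - m`
  -- makes up for what is missing from `n`.
  have h3 : (s : ℝ) - m ≤ ((p ^ s * j : ℕ) : ℝ) / (p : ℝ) ^ m := by
    rcases le_total s m with h | h
    · have : (s : ℝ) ≤ m := by exact_mod_cast h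
      have : (0 : ℝ) ≤ ((p ^ s * j : ℕ) : ℝ) / (p : ℝ) ^ m := by positivity
      linarith
    · obtain ⟨t, rfl⟩ := Nat.exists_eq_add_of_le h
      rw [le_div_iff₀ (by positivity)]
      have : t * p ^ m ≤ p ^ (m + t) * j := by
        calc t * p ^ m ≤ p ^ t * p ^ m := Nat.mul_le_mul_right _ (Nat.lt_pow_self hp.one_lt).le
          _ = p ^ (m + t) * 1 := by ring
          _ ≤ _ := Nat.mul_le_mul_left _ hj1
      have h' : ((t * p ^ m : ℕ) : ℝ) ≤ ((p ^ (m + t) * j : ℕ) : ℝ) := by exact_mod_cast this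
      push_cast at h' ⊢
      linarith
  linarith

theorem one_add_tT_pow_sub_one_mem (m n : ℕ) :
    (1 + tT p m) ^ p ^ (m + n) - 1 ∈ finiteSums p n := by
  rw [add_comm, add_pow, Finset.sum_range_succ']
  simp only [one_pow, mul_one, pow_zero, Nat.choose_zero_right, Nat.cast_one, add_sub_cancel_right]
  refine sum_mem fun i _ => ?_
  rw [mul_comm, natCast_mul_eq_smul, ← tPow_sFrac]
  exact smul_tPow_mem_finiteSums (le_weight_choose m n i.succ_ne_zero)

theorem p_pow_dvd_dirac_pow_sub (m k : ℕ) : (p : UnifMeasure p) ^ (k + 1) ∣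
    dirac (1 / (p : ℚ_[p]) ^ m) ^ p ^ k - (1 + tT p m) ^ p ^ k := by
  refine dvd_sub_pow_of_dvd_sub ?_ k
  rw [dirac_eq_one_add_T, add_sub_add_left_eq_sub]
  exact dvd_sub_comm.1 (p_dvd_tT_sub_T m)

/-- `Δ_(p^n) = Δ_(1/p^k)^(p^(k+n))` agrees with `(1 + T̃_k)^(p^(k+n))` modulo `p^(k+n+1)`, and the
latter is `1` up to weight `n` for every `k`. -/
theorem dirac_p_pow_sub_one_mem (n : ℕ) : dirac ((p : ℚ_[p]) ^ n) - 1 ∈ weightClosure p n := by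
  refine mem_of_forall_exists_sub_mem (isClosed_weightClosure _) fun k =>
    ⟨_, finiteSums_le_weightClosure _ (one_add_tT_pow_sub_one_mem k n), ?_⟩
  have h := p_pow_dvd_iff.1 (p_pow_dvd_dirac_pow_sub (p := p) k (k + n)) k
  have hd : dirac (1 / (p : ℚ_[p]) ^ k) ^ p ^ (k + n) = dirac ((p : ℚ_[p]) ^ n) := by
    have := padic_p_ne_zero (p := p)
    rw [dirac_pow]
    congr 1
    push_cast
    field_simp
    ring
  rw [hd] at h
  rw [sub_sub_sub_cancel_right]
  exact nbhdIdeal_anti le_rfl (by omega) h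

theorem dirac_one_div_mem (j : ℕ) : dirac (1 / (p : ℚ_[p]) ^ j) ∈ weightClosure p 0 := by
  refine mem_of_forall_exists_sub_mem (isClosed_weightClosure _) fun k =>
    ⟨_, finiteSums_le_weightClosure _ (one_add_tT_pow_mem (j + k) (p ^ k)), ?_⟩
  have h := p_pow_dvd_iff.1 (p_pow_dvd_dirac_pow_sub (p := p) (j + k) k) k
  rw [dirac_p_pow_pow] at h
  exact nbhdIdeal_anti le_rfl (by omega) h

theorem continuous_dirac : Continuous (dirac : ℚ_[p] → UnifMeasure p) := by
  refine continuous_iff_continuousAt.2 fun x => tendsto_iff_eventually_sub_mem.2 fun n => ?_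
  have hp0 := real_p_pos (p := p)
  filter_upwards [Metric.closedBall_mem_nhds x (show 0 < (p : ℝ) ^ (-(n : ℤ)) by positivity)]
    with y hy
  refine dirac_sub_dirac_mem (proj_eq_iff.2 ?_) n
  rwa [mem_closedBall_iff_norm] at hy

theorem exists_padic_eq_div (x : ℚ_[p]) : ∃ (z : ℤ_[p]) (j : ℕ), x = z * (1 / (p : ℚ_[p]) ^ j) := by
  have hp : (1 : ℝ) < p := by exact_mod_cast (Fact.out : p.Prime).one_lt
  obtain ⟨j, hj⟩ := pow_unbounded_of_one_lt ‖x‖ hp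
  have := padic_p_ne_zero (p := p)
  refine ⟨⟨x * (p : ℚ_[p]) ^ j, ?_⟩, j, ?_⟩
  · rw [norm_mul, norm_pow, Padic.norm_p, inv_pow, ← div_eq_mul_inv]
    exact (div_le_one (by positivity)).2 hj.le
  · field_simp

/-- Write `x = z / p^j` with `z ∈ ℤ_p`. For natural `z` this is a power of `Δ_(1/p^j)`; the general
case follows by density and continuity of `x ↦ Δ_x`. -/
theorem dirac_mem_weightClosure (x : ℚ_[p]) : dirac x ∈ weightClosure p 0 := by
  obtain ⟨z, j, rfl⟩ := exists_padic_eq_div x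
  have hc : Continuous fun z : ℤ_[p] => dirac ((z : ℚ_[p]) * (1 / (p : ℚ_[p]) ^ j)) :=
    continuous_dirac.comp (continuous_subtype_val.mul continuous_const)
  refine PadicInt.denseRange_natCast.induction_on z ((isClosed_weightClosure 0).preimage hc) ?_
  intro m
  rw [PadicInt.coe_natCast, ← dirac_pow]
  induction m with
  | zero => rw [pow_zero, ← tPow_zero]
            exact finiteSums_le_weightClosure _ (tPow_mem_finiteSums_zero _)
  | succ m ih => rw [pow_succ]; simpa using mul_mem_weightClosure ih (dirac_one_div_mem j)

theorem smul_mem_weightClosure_zero (a : ℤ_[p]) {x : UnifMeasure p}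
    (hx : x ∈ weightClosure p 0) : a • x ∈ weightClosure p 0 := by
  have := mul_mem_weightClosure (finiteSums_le_weightClosure _
    (smul_tPow_mem_finiteSums (zero_le_weight a 0))) hx
  rwa [tPow_zero, smul_mul_assoc, one_mul, add_zero] at this

/-! ### Approximation by Dirac masses; the natural topology refines the weight topology. -/

/-- The value at a ball as an additive homomorphism. -/
def ballHom (h : ℕ) (c : Balls p h) : UnifMeasure p →+ ℤ_[p] where
  toFun μ := μ.ball h c
  map_zero' := rfl
  map_add' _ _ := rfl

theorem sum_smul_ball {ι : Type*} (s : Finset ι) (a : ι → ℤ_[p]) (μ : ι → UnifMeasure p) (h : ℕ)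
    (c : Balls p h) : (∑ i ∈ s, a i • μ i).ball h c = ∑ i ∈ s, a i * (μ i).ball h c :=
  map_sum (ballHom h c) _ _

theorem proj_out {h : ℕ} (c : Balls p h) : proj p h (Quotient.out c) = c := Quotient.out_eq c

/-- The masses of the balls of radius `n` are summable, so all but finitely many are divisible by
`p^n`; each of the others is concentrated at a point of its ball. -/
theorem exists_sub_sum_dirac_mem (μ : UnifMeasure p) (n : ℕ) : ∃ s : Finset (Balls p n),
    μ - ∑ c ∈ s, μ.ball n c • dirac (Quotient.out c : ℚ_[p]) ∈ nbhdIdeal p n n := by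
  have h := (padicInt_hasBasis_nhds_zero.tendsto_right_iff.1
    (μ.hasSum_ball n).summable.tendsto_cofinite_zero) n trivial
  refine ⟨(eventually_cofinite.1 h).toFinset, fun c => ?_⟩
  classical
  rw [sub_ball, sum_smul_ball]
  simp only [dirac_ball, proj_out, mul_ite, mul_one, mul_zero, Finset.sum_ite_eq',
    Finite.mem_toFinset]
  split_ifs with hc
  · simp
  · simpa using hc

theorem weightClosure_zero : weightClosure p 0 = ⊤ := by
  refine eq_top_iff.2 fun μ _ => mem_of_forall_exists_sub_mem (isClosed_weightClosure _) fun n => ?_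
  obtain ⟨s, hs⟩ := exists_sub_sum_dirac_mem μ n
  exact ⟨_, sum_mem fun c _ => smul_mem_weightClosure_zero _ (dirac_mem_weightClosure _), hs⟩

theorem mul_mem_weightClosure_right {C : ℝ} {x : UnifMeasure p} (hx : x ∈ weightClosure p C)
    (y : UnifMeasure p) : x * y ∈ weightClosure p C := by
  have := mul_mem_weightClosure hx (weightClosure_zero (p := p) ▸ AddSubgroup.mem_top y)
  rwa [add_zero] at this

theorem smul_mem_weightClosure {C : ℝ} (a : ℤ_[p]) {x : UnifMeasure p}
    (hx : x ∈ weightClosure p C) : a • x ∈ weightClosure p C := by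
  rw [Algebra.smul_def, mul_comm]
  exact mul_mem_weightClosure_right hx _

/-- The difference is `(Δ_(z p^n) - 1) Δ_y` with `z ∈ ℤ_p`; for natural `z` the first factor is a
multiple of `Δ_(p^n) - 1`, and density does the rest. -/
theorem dirac_sub_dirac_mem_weightClosure {n : ℕ} {x y : ℚ_[p]} (h : proj p n x = proj p n y) :
    dirac x - dirac y ∈ weightClosure p n := by
  suffices H : ∀ z : ℤ_[p], dirac ((z : ℚ_[p]) * (p : ℚ_[p]) ^ n) - 1 ∈ weightClosure p n by
    have hp := padic_p_ne_zero (p := p)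
    have hp0 := real_p_pos (p := p)
    rw [proj_eq_iff] at h
    have hz : ‖(x - y) / (p : ℚ_[p]) ^ n‖ ≤ 1 := by
      rw [norm_div, norm_pow, Padic.norm_p]
      refine (div_le_one (by positivity)).2 (h.trans_eq ?_)
      rw [zpow_neg, zpow_natCast, inv_pow]
    have h1 := mul_mem_weightClosure_right (H ⟨_, hz⟩) (dirac y)
    rw [sub_mul, one_mul, dirac_mul] at h1
    convert! h1 using 3
    simp only
    field_simp
    ring
  intro z
  have hc : Continuous fun z : ℤ_[p] => dirac ((z : ℚ_[p]) * (p : ℚ_[p]) ^ n) - 1 :=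
    (continuous_dirac.comp (continuous_subtype_val.mul continuous_const)).sub continuous_const
  refine PadicInt.denseRange_natCast.induction_on z ((isClosed_weightClosure n).preimage hc) ?_
  intro m
  rw [PadicInt.coe_natCast, ← dirac_pow]
  obtain ⟨r, hr⟩ := sub_one_dvd_pow_sub_one (dirac ((p : ℚ_[p]) ^ n)) m
  rw [hr]
  exact mul_mem_weightClosure_right (dirac_p_pow_sub_one_mem n) r

theorem smul_mem_weightClosure_of_dvd {n : ℕ} {a : ℤ_[p]} (ha : (p : ℤ_[p]) ^ n ∣ a)
    (x : UnifMeasure p) : a • x ∈ weightClosure p n := by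
  have := mul_mem_weightClosure_right (finiteSums_le_weightClosure _
    (smul_tPow_mem_finiteSums (C := n) (a := a) (q := 0)
      (le_weight_iff.2 (by simpa using ha)))) x
  rwa [tPow_zero, smul_mul_assoc, one_mul] at this

/-- Moving each mass to the chosen representative of its ball changes nothing up to weight `n`;
afterwards the coefficients are masses of balls, which are divisible by `p^n`. -/
theorem sum_smul_dirac_mem_weightClosure {ι : Type*} {n : ℕ} (s : Finset ι) (a : ι → ℤ_[p])
    (x : ι → ℚ_[p]) (h : ∑ i ∈ s, a i • dirac (x i) ∈ nbhdIdeal p n n) :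
    ∑ i ∈ s, a i • dirac (x i) ∈ weightClosure p n := by
  classical
  have h1 : ∑ i ∈ s, a i • (dirac (x i) - dirac (Quotient.out (proj p n (x i)) : ℚ_[p])) ∈
      weightClosure p n := sum_mem fun i _ => smul_mem_weightClosure _
        (dirac_sub_dirac_mem_weightClosure (proj_out _).symm)
  have h2 : ∑ i ∈ s, a i • dirac (Quotient.out (proj p n (x i)) : ℚ_[p]) ∈ weightClosure p n := by
    rw [← Finset.sum_fiberwise_of_maps_to (t := s.image fun i => proj p n (x i))
      (g := fun i => proj p n (x i)) fun i hi => Finset.mem_image_of_mem _ hi]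
    refine sum_mem fun d _ => ?_
    rw [Finset.sum_congr rfl (g := fun i => a i • dirac (Quotient.out d : ℚ_[p])) fun i hi => by
      rw [(Finset.mem_filter.1 hi).2], ← Finset.sum_smul]
    refine smul_mem_weightClosure_of_dvd ?_ _
    have := h d
    rw [sum_smul_ball] at this
    simpa only [dirac_ball, mul_ite, mul_one, mul_zero, ← Finset.sum_filter] using this
  have := add_mem h1 h2
  rw [← Finset.sum_add_distrib] at this
  simpa only [← smul_add, sub_add_cancel] using this

theorem nbhdIdeal_le_weightClosure {n : ℕ} {μ : UnifMeasure p} (h : μ ∈ nbhdIdeal p n n) :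
    μ ∈ weightClosure p n := by
  refine mem_of_forall_exists_sub_mem (isClosed_weightClosure _) fun k => ?_
  obtain ⟨s, hs⟩ := exists_sub_sum_dirac_mem μ (max n k)
  refine ⟨_, sum_smul_dirac_mem_weightClosure _ _ _ ?_,
    nbhdIdeal_anti (le_max_right n k) (le_max_right n k) hs⟩
  have := sub_mem h (nbhdIdeal_anti (le_max_left n k) (le_max_left n k) hs)
  rwa [sub_sub_cancel] at this

/-! ### Existence of the expansion in an `S`-series. -/

theorem weight_eq_top_iff {a : ℤ_[p]} {q : S p} : weight a q = ⊤ ↔ a = 0 := by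
  refine ⟨fun h => ?_, fun h => by rw [h, weight_zero]⟩
  by_contra ha
  rw [weight_of_ne_zero ha] at h
  exact WithTop.coe_ne_top h

theorem min_le_weight_add (a b : ℤ_[p]) (q : S p) :
    min (weight a q) (weight b q) ≤ weight (a + b) q := by
  rcases h : min (weight a q) (weight b q) with _ | C
  · have h' : ⊤ ≤ min (weight a q) (weight b q) := h.ge
    rw [weight_eq_top_iff.1 (top_le_iff.1 (h'.trans (min_le_left _ _))),
      weight_eq_top_iff.1 (top_le_iff.1 (h'.trans (min_le_right _ _))), add_zero, weight_zero]
    exact le_top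
  · have h' : (C : WithTop ℝ) ≤ min (weight a q) (weight b q) := h.ge
    exact le_weight_add (h'.trans (min_le_left _ _)) (h'.trans (min_le_right _ _))

theorem weight_neg (a : ℤ_[p]) (q : S p) : weight (-a) q = weight a q := by
  have h : ∀ a : ℤ_[p], weight a q ≤ weight (-a) q := fun a => by
    by_cases ha : a = 0
    · simp [ha]
    · rw [weight_of_ne_zero ha]
      exact le_weight_neg (weight_of_ne_zero ha q).ge
  exact le_antisymm (by simpa using h (-a)) (h a)

theorem le_weight_of_hasSum {ι : Type*} {C : ℝ} {f : ι → ℤ_[p]} {a : ℤ_[p]} {q : S p}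
    (hf : ∀ i, (C : WithTop ℝ) ≤ weight (f i) q) (h : HasSum f a) :
    (C : WithTop ℝ) ≤ weight a q :=
  le_weight_iff.2 (pow_dvd_of_hasSum (fun i => le_weight_iff.1 (hf i)) h)

theorem WeightsTendToTop.add {a b : S p → ℤ_[p]} (ha : WeightsTendToTop a)
    (hb : WeightsTendToTop b) : WeightsTendToTop (a + b) := fun C hC => by
  filter_upwards [ha C hC, hb C hC] with q h1 h2
  exact (lt_min h1 h2).trans_le (min_le_weight_add _ _ _)

theorem WeightsTendToTop.neg {a : S p → ℤ_[p]} (ha : WeightsTendToTop a) :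
    WeightsTendToTop (-a) := fun C hC => by
  filter_upwards [ha C hC] with q h1
  rwa [Pi.neg_apply, weight_neg]

theorem WeightsTendToTop.mono {a b : S p → ℤ_[p]} (ha : WeightsTendToTop a)
    (h : ∀ q, weight (a q) q ≤ weight (b q) q) : WeightsTendToTop b := fun C hC =>
  (ha C hC).mono fun q hq => hq.trans_le (h q)

theorem weightsTendToTop_finsupp (f : S p →₀ ℤ_[p]) : WeightsTendToTop f := fun C _ => by
  filter_upwards [f.support.finite_toSet.compl_mem_cofinite] with q hq
  rw [Finsupp.notMem_support_iff.1 (by simpa using hq), weight_zero]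
  exact WithTop.coe_lt_top C

theorem hasSum_finsupp (f : S p →₀ ℤ_[p]) :
    HasSum (fun q => f q • tPow q) (f.sum fun q a => a • tPow q) :=
  hasSum_sum_of_ne_finset_zero fun q hq => by
    rw [Finsupp.notMem_support_iff.1 hq, zero_smul]

theorem summable_of_weights {ι : Type*} {a : ι → ℤ_[p]} {q : ι → S p}
    (h : ∀ C : ℝ, 0 < C → ∀ᶠ i in cofinite, (C : WithTop ℝ) < weight (a i) (q i)) :
    Summable fun i => a i • tPow (q i) := by
  refine NonarchimedeanAddGroup.summable_of_tendsto_cofinite_zero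
    (hasBasis_nhds_zero.tendsto_right_iff.2 fun n _ => ?_)
  filter_upwards [h (n * p ^ n + n + 1) (by positivity)] with i hi
  exact smul_tPow_mem_nbhdIdeal
    (le_trans (WithTop.coe_le_coe.2 (by linarith)) hi.le)

theorem WeightsTendToTop.summable {a : S p → ℤ_[p]} (ha : WeightsTendToTop a) :
    Summable fun q => a q • tPow q := summable_of_weights ha

theorem exists_finsupp_of_mem_finiteSums {C : ℝ} {x : UnifMeasure p} (hx : x ∈ finiteSums p C) :
    ∃ f : S p →₀ ℤ_[p], (∀ q, (C : WithTop ℝ) ≤ weight (f q) q) ∧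
      (f.sum fun q a => a • tPow q) = x := by
  induction hx using AddSubgroup.closure_induction with
  | mem x hx =>
    obtain ⟨a, q, ha, rfl⟩ := hx
    classical
    refine ⟨Finsupp.single q a, fun r => ?_, Finsupp.sum_single_index (zero_smul _ _)⟩
    rw [Finsupp.single_apply]
    split_ifs with h
    · rwa [← h]
    · rw [weight_zero]; exact le_top
  | zero => exact ⟨0, fun q => by simp, by simp⟩
  | add x y _ _ hx hy =>
    obtain ⟨f, hf, rfl⟩ := hx
    obtain ⟨g, hg, rfl⟩ := hy
    exact ⟨f + g, fun q => le_weight_add (hf q) (hg q),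
      Finsupp.sum_add_index' (fun _ => zero_smul _ _) (fun _ _ _ => add_smul _ _ _)⟩
  | neg x _ hx =>
    obtain ⟨f, hf, rfl⟩ := hx
    exact ⟨-f, fun q => le_weight_neg (hf q), by
      simp [Finsupp.sum]⟩

theorem mem_finiteSums_of_finsupp {C : ℝ} (f : S p →₀ ℤ_[p])
    (hf : ∀ q, (C : WithTop ℝ) ≤ weight (f q) q) :
    (f.sum fun q a => a • tPow q) ∈ finiteSums p C :=
  sum_mem fun q _ => smul_tPow_mem_finiteSums (hf q)

/-- Successive approximation: a remainder in `nbhdIdeal p i i` lies in `weightClosure p i`, so a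
finite sum of weight at least `i` moves it into `nbhdIdeal p (i + 1) (i + 1)`. -/
theorem exists_finiteSums_hasSum {n : ℕ} {μ : UnifMeasure p} (h : μ ∈ nbhdIdeal p n n) :
    ∃ y : ℕ → UnifMeasure p, (∀ i : ℕ, y i ∈ finiteSums p ((n + i : ℕ) : ℝ)) ∧ HasSum y μ := by
  have step : ∀ i : ℕ, ∀ r : nbhdIdeal p i i, ∃ y ∈ finiteSums p i,
      (r : UnifMeasure p) - y ∈ nbhdIdeal p (i + 1) (i + 1) := fun i r =>
    exists_finiteSums_sub_mem (nbhdIdeal_le_weightClosure r.2) (i + 1)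
  choose f hf hfr using step
  let r : ∀ i : ℕ, nbhdIdeal p (n + i) (n + i) := fun i =>
    Nat.rec (motive := fun i => nbhdIdeal p (n + i) (n + i)) ⟨μ, h⟩
      (fun i r => ⟨(r : UnifMeasure p) - f (n + i) r, hfr (n + i) r⟩) i
  have hr : ∀ i, (r (i + 1) : UnifMeasure p) = r i - f (n + i) (r i) := fun i => rfl
  let y : ℕ → UnifMeasure p := fun i => f (n + i) (r i)
  have hsum : ∀ k, ∑ i ∈ Finset.range k, y i = μ - r k := by
    intro k
    induction k with
    | zero => exact (sub_self μ).symm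
    | succ k ih => rw [Finset.sum_range_succ, ih, hr]; simp only [y]; abel
  have hr0 : Tendsto (fun i => (r i : UnifMeasure p)) atTop (𝓝 0) := by
    refine hasBasis_nhds_zero.tendsto_right_iff.2 fun k _ => ?_
    filter_upwards [eventually_ge_atTop k] with i hi
    exact nbhdIdeal_anti (by omega) (by omega) (r i).2
  have hy0 : Tendsto y atTop (𝓝 0) := by
    have h1 := hr0.sub (hr0.comp (tendsto_add_atTop_nat 1))
    rw [sub_zero] at h1
    refine h1.congr fun i => ?_
    simp only [Function.comp_apply, hr, y]
    abel
  refine ⟨y, fun i => hf (n + i) (r i), ?_⟩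
  have hs : Summable y := NonarchimedeanAddGroup.summable_of_tendsto_cofinite_zero
    (Nat.cofinite_eq_atTop ▸ hy0)
  have h1 : Tendsto (fun k => ∑ i ∈ Finset.range k, y i) atTop (𝓝 μ) := by
    simp only [hsum]
    simpa using hr0.const_sub μ
  rw [← tendsto_nhds_unique hs.hasSum.tendsto_sum_nat h1]
  exact hs.hasSum

theorem exists_series_of_mem_nbhdIdeal {n : ℕ} {μ : UnifMeasure p} (h : μ ∈ nbhdIdeal p n n) :
    ∃ a : S p → ℤ_[p], WeightsTendToTop a ∧ HasSum (fun q => a q • tPow q) μ ∧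
      ∀ q, ((n : ℝ) : WithTop ℝ) ≤ weight (a q) q := by
  obtain ⟨y, hy, hμ⟩ := exists_finiteSums_hasSum h
  choose b hb hby using fun i => exists_finsupp_of_mem_finiteSums (hy i)
  have hle : ∀ {i j : ℕ} (q : S p), i ≤ n + j → ((i : ℝ) : WithTop ℝ) ≤ weight (b j q) q :=
    fun q hij => le_trans (WithTop.coe_le_coe.2 (by exact_mod_cast hij)) (hb _ q)
  have hsupp : ∀ k : ℕ, (⋃ i ∈ Finset.range k, ((b i).support : Set (S p))).Finite := fun k =>
    (Finset.range k).finite_toSet.biUnion fun i _ => (b i).support.finite_toSet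
  have hF : Summable fun x : ℕ × S p => b x.1 x.2 • tPow x.2 := by
    refine summable_of_weights fun C hC => ?_
    -- From the index `⌊C⌋₊ + 1` on, all weights exceed `C`; the earlier finite sums have finitely
    -- many terms.
    have hfin := ((Finset.range (⌊C⌋₊ + 1)).finite_toSet).prod (hsupp (⌊C⌋₊ + 1))
    filter_upwards [hfin.compl_mem_cofinite] with x hx
    by_cases hx1 : x.1 < ⌊C⌋₊ + 1
    · have : b x.1 x.2 = 0 := by
        by_contra hne
        exact hx ⟨by simpa using hx1, mem_biUnion (by simpa using hx1) (by simpa using hne)⟩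
      rw [this, weight_zero]
      exact WithTop.coe_lt_top C
    · refine lt_of_lt_of_le (WithTop.coe_lt_coe.2 (Nat.lt_floor_add_one C)) ?_
      exact_mod_cast hle (i := ⌊C⌋₊ + 1) x.2 (by omega)
  have hFμ : HasSum (fun x : ℕ × S p => b x.1 x.2 • tPow x.2) μ := by
    have := hF.hasSum.prod_fiberwise fun i => hby i ▸ hasSum_finsupp (b i)
    rw [← this.unique hμ]
    exact hF.hasSum
  have hcol : ∀ q, Summable fun i => b i q := fun q => by
    refine NonarchimedeanAddGroup.summable_of_tendsto_cofinite_zero ?_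
    rw [Nat.cofinite_eq_atTop]
    refine padicInt_hasBasis_nhds_zero.tendsto_right_iff.2 fun k _ => ?_
    filter_upwards [eventually_ge_atTop (k + ⌈(q : ℝ)⌉₊)] with i hi
    refine (pow_dvd_pow _ ?_).trans (le_weight_iff.1 (hle (i := i) q (by omega)))
    have h1 : ((k + ⌈(q : ℝ)⌉₊ : ℕ) : ℝ) ≤ i := by exact_mod_cast hi
    have h2 := Nat.le_ceil (q : ℝ)
    push_cast at h1
    have h3 : (k : ℝ) ≤ ⌈(i : ℝ) - q⌉₊ := le_trans (by linarith) (Nat.le_ceil _)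
    exact_mod_cast h3
  -- The double series is summed the other way: collecting equal exponents gives the coefficients.
  refine ⟨fun q => ∑' i, b i q, fun C hC => ?_, ?_, fun q => ?_⟩
  · filter_upwards [(hsupp (⌊C⌋₊ + 1)).compl_mem_cofinite] with q hq
    refine lt_of_lt_of_le (WithTop.coe_lt_coe.2 (Nat.lt_floor_add_one C)) ?_
    refine le_weight_of_hasSum (fun i => ?_) (hcol q).hasSum
    by_cases hi : i < ⌊C⌋₊ + 1
    · have : b i q = 0 := by
        by_contra hne
        exact hq (mem_biUnion (by simpa using hi) (by simpa using hne))
      rw [this, weight_zero]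
      exact le_top
    · exact_mod_cast hle (i := ⌊C⌋₊ + 1) q (by omega)
  · refine ((Equiv.prodComm (S p) ℕ).hasSum_iff.2 hFμ).prod_fiberwise fun q => ?_
    exact (hcol q).hasSum.map (LinearMap.toSpanSingleton ℤ_[p] _ (tPow q))
      (continuous_smul_const (tPow q))
  · exact le_weight_of_hasSum (fun i => hle q (by omega)) (hcol q).hasSum

theorem exists_series (μ : UnifMeasure p) :
    ∃ a : S p → ℤ_[p], WeightsTendToTop a ∧ HasSum (fun q => a q • tPow q) μ := by
  obtain ⟨a, h1, h2, -⟩ := exists_series_of_mem_nbhdIdeal (n := 0) (μ := μ)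
    (nbhdIdeal_zero (p := p) 0 ▸ Submodule.mem_top)
  exact ⟨a, h1, h2⟩

theorem exists_series_of_mem_weightClosure {C : ℝ} {μ : UnifMeasure p}
    (h : μ ∈ weightClosure p C) :
    ∃ a : S p → ℤ_[p], WeightsTendToTop a ∧ HasSum (fun q => a q • tPow q) μ ∧
      ∀ q, (C : WithTop ℝ) ≤ weight (a q) q := by
  obtain ⟨y, hy, hμy⟩ := exists_finiteSums_sub_mem h ⌈C⌉₊
  obtain ⟨f, hf, rfl⟩ := exists_finsupp_of_mem_finiteSums hy
  obtain ⟨a, ha, hs, haC⟩ := exists_series_of_mem_nbhdIdeal hμy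
  refine ⟨f + a, (weightsTendToTop_finsupp f).add ha, ?_, fun q => le_weight_add (hf q)
    ((WithTop.coe_le_coe.2 (Nat.le_ceil C)).trans (haC q))⟩
  have := (hasSum_finsupp f).add hs
  rw [add_sub_cancel] at this
  simpa only [Pi.add_apply, add_smul] using this

theorem mem_weightClosure_of_hasSum {C : ℝ} {μ : UnifMeasure p} {a : S p → ℤ_[p]}
    (ha : ∀ q, (C : WithTop ℝ) ≤ weight (a q) q) (h : HasSum (fun q => a q • tPow q) μ) :
    μ ∈ weightClosure p C :=
  hasSum_mem_of_isClosed (isClosed_weightClosure C)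
    (fun q => finiteSums_le_weightClosure _ (smul_tPow_mem_finiteSums (ha q))) h

/-! ### Uniqueness of the expansion. -/

theorem proj_div_injOn (n h : ℕ) {k k' : ℕ} (hk : k < p ^ (n + h)) (hk' : k' < p ^ (n + h))
    (H : proj p h (k * (1 / (p : ℚ_[p]) ^ n)) = proj p h (k' * (1 / (p : ℚ_[p]) ^ n))) :
    k = k' := by
  have hp0 := real_p_pos (p := p)
  rw [proj_eq_iff, ← sub_mul, norm_mul, norm_div, norm_one, norm_pow, Padic.norm_p, inv_pow,
    one_div, inv_inv, ← le_div_iff₀ (by positivity)] at H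
  have H' : ‖((((k : ℤ) - k' : ℤ)) : ℚ_[p])‖ ≤ (p : ℝ) ^ (-((n + h : ℕ) : ℤ)) := by
    push_cast
    refine H.trans_eq ?_
    rw [neg_add, zpow_add₀ hp0.ne', zpow_neg, zpow_neg, zpow_natCast, zpow_natCast, div_eq_mul_inv,
      mul_comm]
  rw [Padic.norm_int_le_pow_iff_dvd] at H'
  have h1 : k ≡ k' [MOD p ^ (n + h)] := by
    refine (Nat.modEq_iff_dvd.2 ?_).symm
    exact_mod_cast H'
  exact Nat.ModEq.eq_of_lt_of_lt h1 hk hk'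

/-- Rewritten in powers of `1 + T_n = Δ_(1/p^n)`, the polynomial has as coefficients its values at
distinct balls of radius `h`. Divisibility of coefficients by `p` survives the substitution back. -/
theorem p_dvd_of_sum_smul_T_pow_mem (n h : ℕ) (a : ℕ → ℤ_[p])
    (H : ∑ i ∈ Finset.range (p ^ (n + h)), a i • T p n ^ i ∈ nbhdIdeal p h 1) {i : ℕ}
    (hi : i < p ^ (n + h)) : (p : ℤ_[p]) ∣ a i := by
  classical
  open Polynomial in
  let P : ℤ_[p][X] := ∑ i ∈ Finset.range (p ^ (n + h)), monomial i (a i)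
  let Q : ℤ_[p][X] := P.comp (X - 1)
  have hPQ : P = Q.comp (X + 1) := by simp [Q, Polynomial.comp_assoc]
  have hPdeg : P.natDegree < p ^ (n + h) := by
    have h0 : 0 < p ^ (n + h) := by omega
    refine lt_of_le_of_lt (Polynomial.natDegree_sum_le_of_forall_le _ _ (n := p ^ (n + h) - 1)
      fun i hi => (Polynomial.natDegree_monomial_le _).trans ?_) (by omega)
    have := Finset.mem_range.1 hi
    omega
  have hQdeg : Q.natDegree < p ^ (n + h) := by
    refine lt_of_le_of_lt Polynomial.natDegree_comp_le ?_
    have : (X - 1 : ℤ_[p][X]).natDegree = 1 := Polynomial.natDegree_X_sub_C 1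
    rwa [this, mul_one]
  have hQ : Polynomial.aeval (dirac (1 / (p : ℚ_[p]) ^ n)) Q ∈ nbhdIdeal p h 1 := by
    have : Polynomial.aeval (dirac (1 / (p : ℚ_[p]) ^ n)) Q
        = ∑ i ∈ Finset.range (p ^ (n + h)), a i • T p n ^ i := by
      rw [Polynomial.aeval_comp, dirac_eq_one_add_T]
      simp [P, Polynomial.aeval_monomial, Algebra.smul_def]
    rwa [this]
  rw [Polynomial.aeval_eq_sum_range' hQdeg] at hQ
  have hQc : ∀ k, (p : ℤ_[p]) ∣ Q.coeff k := by
    intro k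
    by_cases hk : k < p ^ (n + h)
    · have h1 := hQ (proj p h (k * (1 / (p : ℚ_[p]) ^ n)))
      rw [sum_smul_ball, Finset.sum_eq_single_of_mem k (Finset.mem_range.2 hk)] at h1
      · rw [dirac_pow, dirac_ball, if_pos rfl] at h1
        simpa using h1
      · intro j hj hjk
        rw [dirac_pow, dirac_ball, if_neg, mul_zero]
        exact fun hh => hjk (proj_div_injOn n h (Finset.mem_range.1 hj) hk hh)
    · rw [Polynomial.coeff_eq_zero_of_natDegree_lt (by omega)]
      exact dvd_zero _
  obtain ⟨R, hR⟩ := (Polynomial.C_dvd_iff_dvd_coeff _ _).2 hQc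
  have hPi : P.coeff i = a i := by
    simp [P, Polynomial.coeff_monomial, hi]
  rw [← hPi, hPQ, hR, Polynomial.mul_comp, Polynomial.C_comp, Polynomial.coeff_C_mul]
  exact dvd_mul_right _ _

theorem sum_mem_of_hasSum_mem {ι G σ : Type*} [AddCommGroup G] [TopologicalSpace G]
    [IsTopologicalAddGroup G] [SetLike σ G] [AddSubgroupClass σ G] {H : σ}
    (hH : IsClosed (H : Set G)) {f : ι → G} {x : G} (hf : HasSum f x) (hx : x ∈ H) (s : Finset ι)
    (hs : ∀ i ∉ s, f i ∈ H) : ∑ i ∈ s, f i ∈ H := by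
  have h1 : x - ∑ i ∈ s, f i ∈ H :=
    hasSum_mem_of_isClosed hH (fun i : {i // i ∉ s} => hs i.1 i.2)
      ((Finset.hasSum_compl_iff s).2 (by simpa using hf))
  simpa using sub_mem hx h1

theorem p_dvd_coeff_of_hasSum {a : S p → ℤ_[p]} {μ : UnifMeasure p} (ha : WeightsTendToTop a)
    (hs : HasSum (fun q => a q • tPow q) μ) (hμ : ∀ h, μ ∈ nbhdIdeal p h 1) (q₀ : S p) :
    (p : ℤ_[p]) ∣ a q₀ := by
  classical
  have hp0 := real_p_pos (p := p)
  obtain ⟨h, hh⟩ := pow_unbounded_of_one_lt (q₀ : ℝ)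
    (show (1 : ℝ) < p by exact_mod_cast (Fact.out : p.Prime).one_lt)
  have hB := eventually_cofinite.1 (ha ((p : ℝ) ^ h) (by positivity))
  -- A common denominator `p^n` of `q₀` and of the finitely many exponents of weight at most `p^h`.
  -- Any other term has exponent at least `p^h` or a coefficient divisible by `p`.
  obtain ⟨n, hn, i₀, hi₀⟩ := ((hB.eventually_all.2 fun q _ => eventually_exists_eq_sFrac q).and
    (eventually_exists_eq_sFrac q₀)).exists
  have hlt : ∀ {i : ℕ}, (sFrac p n i : ℝ) < (p : ℝ) ^ h → i < p ^ (n + h) := fun {i} hi => by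
    rw [coe_sFrac, div_lt_iff₀ (by positivity), ← pow_add, add_comm] at hi
    exact_mod_cast hi
  obtain ⟨s, hsdef⟩ : ∃ s : Finset (S p), s = (Finset.range (p ^ (n + h))).image (sFrac p n) :=
    ⟨_, rfl⟩
  have hout : ∀ q ∉ s, a q • tPow q ∈ nbhdIdeal p h 1 := by
    intro q hq
    by_cases hqh : (p : ℝ) ^ h ≤ q
    · exact smul_mem_ideal _ _ (tPow_mem_nbhdIdeal (by simpa using hqh))
    · push Not at hqh
      by_cases hqB : (((p : ℝ) ^ h : ℝ) : WithTop ℝ) < weight (a q) q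
      · refine smul_mem_nbhdIdeal ((pow_dvd_pow _ ?_).trans (le_weight_iff.1 hqB.le)) _ _
        exact Nat.one_le_ceil_iff.2 (by linarith)
      · obtain ⟨i, rfl⟩ := hn q hqB
        refine absurd ?_ hq
        rw [hsdef]
        exact Finset.mem_image_of_mem _ (Finset.mem_range.2 (hlt hqh))
  have h2 := sum_mem_of_hasSum_mem (isClosed_nbhdIdeal h 1) hs (hμ h) s hout
  rw [hsdef, Finset.sum_image (sFrac_injective n).injOn] at h2
  simp only [tPow_sFrac] at h2
  -- Modulo `p`, `T̃_n` may be replaced by `T_n`.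
  have h3 : ∑ i ∈ Finset.range (p ^ (n + h)), a (sFrac p n i) • T p n ^ i ∈ nbhdIdeal p h 1 := by
    have hd : (p : UnifMeasure p) ^ 1 ∣ ∑ i ∈ Finset.range (p ^ (n + h)),
        (a (sFrac p n i) • tT p n ^ i - a (sFrac p n i) • T p n ^ i) := by
      refine Finset.dvd_sum fun i _ => ?_
      rw [← smul_sub, Algebra.smul_def, pow_one]
      exact ((p_dvd_tT_sub_T n).trans (sub_dvd_pow_sub_pow _ _ i)).mul_left _
    have := sub_mem h2 (p_pow_dvd_iff.1 hd h)
    rwa [Finset.sum_sub_distrib, sub_sub_cancel] at this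
  subst hi₀
  exact p_dvd_of_sum_smul_T_pow_mem n h (fun i => a (sFrac p n i)) h3 (hlt hh)

theorem weight_p_pow_mul (n : ℕ) (a : ℤ_[p]) (q : S p) :
    weight ((p : ℤ_[p]) ^ n * a) q = ((n : ℝ) : WithTop ℝ) + weight a q := by
  have := weight_mul ((p : ℤ_[p]) ^ n) a 0 q
  rw [zero_add] at this
  rw [this, weight_of_ne_zero (pow_ne_zero _ padicInt_p_ne_zero), PadicInt.valuation_pow,
    PadicInt.valuation_p]
  simp

theorem weight_p_mul (a : ℤ_[p]) (q : S p) :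
    weight ((p : ℤ_[p]) * a) q = ((1 : ℝ) : WithTop ℝ) + weight a q := by
  simpa using weight_p_pow_mul 1 a q

/-- All coefficients are divisible by `p`, and the quotient series again has sum `0` because there
is no `p`-torsion; so they are divisible by every power of `p`. -/
theorem eq_zero_of_hasSum_zero {a : S p → ℤ_[p]} (ha : WeightsTendToTop a)
    (hs : HasSum (fun q => a q • tPow q) 0) : a = 0 := by
  suffices H : ∀ (k : ℕ) (a : S p → ℤ_[p]), WeightsTendToTop a →
      HasSum (fun q => a q • tPow q) 0 → ∀ q, (p : ℤ_[p]) ^ k ∣ a q from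
    funext fun q => eq_zero_of_forall_pow_dvd fun k => H k a ha hs q
  intro k
  induction k with
  | zero => intros; simp
  | succ k ih =>
    intro a ha hs q
    choose b hb using p_dvd_coeff_of_hasSum ha hs fun h => zero_mem _
    have hbw : WeightsTendToTop b := fun C hC => by
      filter_upwards [ha (1 + C) (by linarith)] with q hq
      rw [hb, weight_p_mul, WithTop.coe_add] at hq
      exact lt_of_add_lt_add_left hq
    have hbs : HasSum (fun q => b q • tPow q) 0 := by
      have h1 := (hbw.summable.hasSum).mul_left (p : UnifMeasure p)
      have h2 : ∀ q, (p : UnifMeasure p) * (b q • tPow q) = a q • tPow q := fun q => by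
        rw [natCast_mul_eq_smul, smul_smul, ← hb]
      simp only [h2] at h1
      have h3 := eq_zero_of_p_mul_eq_zero (h1.unique hs)
      rw [← h3]
      exact hbw.summable.hasSum
    rw [hb, pow_succ']
    exact mul_dvd_mul_left _ (ih b hbw hbs q)

theorem series_unique {a b : S p → ℤ_[p]} {μ : UnifMeasure p} (ha : WeightsTendToTop a)
    (hb : WeightsTendToTop b) (has : HasSum (fun q => a q • tPow q) μ)
    (hbs : HasSum (fun q => b q • tPow q) μ) : a = b := by
  rw [← sub_eq_zero]
  refine eq_zero_of_hasSum_zero (by rw [sub_eq_add_neg]; exact ha.add hb.neg) ?_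
  simpa only [Pi.sub_apply, sub_smul, sub_self] using has.sub hbs

/-! ### The function `w` and its multiplicativity. -/

theorem exists_isLeast_weight {a : S p → ℤ_[p]} (ha : WeightsTendToTop a) :
    ∃ m, IsLeast (range fun q : S p => weight (a q) q) m := by
  by_cases h0 : a = 0
  · exact ⟨⊤, ⟨0, by simp [h0]⟩, by rintro _ ⟨q, rfl⟩; simp [h0]⟩
  obtain ⟨q₀, hq₀⟩ : ∃ q, a q ≠ 0 := by
    by_contra! H
    exact h0 (funext H)
  have hpos : 0 < (a q₀).valuation + (q₀ : ℝ) + 1 := by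
    have := S_nonneg q₀
    positivity
  have hB := eventually_cofinite.1 (ha _ hpos)
  have hlt : weight (a q₀) q₀ < (((a q₀).valuation + (q₀ : ℝ) + 1 : ℝ) : WithTop ℝ) := by
    rw [weight_of_ne_zero hq₀]
    exact WithTop.coe_lt_coe.2 (by linarith)
  obtain ⟨q₁, -, hmin⟩ := Set.exists_min_image _ (fun q => weight (a q) q) hB
    ⟨q₀, fun h => absurd (h.trans hlt) (lt_irrefl _)⟩
  refine ⟨_, ⟨q₁, rfl⟩, ?_⟩
  rintro _ ⟨q, rfl⟩
  by_cases hq : (((a q₀).valuation + (q₀ : ℝ) + 1 : ℝ) : WithTop ℝ) < weight (a q) q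
  · exact (hmin q₀ fun h => absurd (h.trans hlt) (lt_irrefl _)).trans (hlt.trans hq).le
  · exact hmin q hq

/-- The least weight of the terms of the `S`-series with sum `μ`. -/
def wFun (μ : UnifMeasure p) : WithTop ℝ :=
  (exists_isLeast_weight (exists_series μ).choose_spec.1).choose

theorem isLeast_wFun {μ : UnifMeasure p} {a : S p → ℤ_[p]} (ha : WeightsTendToTop a)
    (hs : HasSum (fun q => a q • tPow q) μ) :
    IsLeast (range fun q : S p => weight (a q) q) (wFun μ) := by
  have h := (exists_series μ).choose_spec
  have hm := (exists_isLeast_weight h.1).choose_spec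
  have := series_unique ha h.1 hs h.2
  rw [this]
  exact hm

/-- Transfers the additive and multiplicative properties of the filtration to `w`. -/
theorem le_wFun_iff {C : ℝ} {μ : UnifMeasure p} :
    (C : WithTop ℝ) ≤ wFun μ ↔ μ ∈ weightClosure p C := by
  constructor
  · obtain ⟨a, ha, hs⟩ := exists_series μ
    exact fun h => mem_weightClosure_of_hasSum
      (fun q => h.trans ((isLeast_wFun ha hs).2 ⟨q, rfl⟩)) hs
  · intro h
    obtain ⟨a, ha, hs, hC⟩ := exists_series_of_mem_weightClosure h
    obtain ⟨q, hq⟩ := (isLeast_wFun ha hs).1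
    rw [← hq]
    exact hC q

theorem wFun_smul_tPow (a : ℤ_[p]) (q : S p) : wFun (a • tPow q) = weight a q := by
  classical
  have hs : HasSum (fun r => Finsupp.single q a r • tPow r) (a • tPow q) := by
    convert! hasSum_finsupp (Finsupp.single q a) using 1
    exact (Finsupp.sum_single_index (h := fun q a => a • tPow q) (zero_smul _ _)).symm
  refine (isLeast_wFun (weightsTendToTop_finsupp _) hs).unique ⟨⟨q, by simp⟩, ?_⟩
  rintro _ ⟨r, rfl⟩
  by_cases h : q = r
  · simp [← h]
  · simp [h]

theorem wFun_zero : wFun (0 : UnifMeasure p) = ⊤ := by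
  have := wFun_smul_tPow (p := p) 0 0
  rwa [zero_smul, weight_zero] at this

theorem wFun_one : wFun (1 : UnifMeasure p) = 0 := by
  have := wFun_smul_tPow (p := p) 1 0
  rw [tPow_zero, one_smul, weight_of_ne_zero one_ne_zero] at this
  simpa using this

theorem eq_zero_of_wFun_eq_top {μ : UnifMeasure p} (h : wFun μ = ⊤) : μ = 0 := by
  obtain ⟨a, ha, hs⟩ := exists_series μ
  have h0 : ∀ q, a q = 0 := fun q => weight_eq_top_iff.1 (top_le_iff.1
    (h ▸ (isLeast_wFun ha hs).2 ⟨q, rfl⟩))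
  simp only [h0, zero_smul] at hs
  exact hs.unique hasSum_zero

theorem min_wFun_le_add (x y : UnifMeasure p) : min (wFun x) (wFun y) ≤ wFun (x + y) := by
  rcases h : min (wFun x) (wFun y) with _ | C
  · have h' : ⊤ ≤ min (wFun x) (wFun y) := h.ge
    rw [eq_zero_of_wFun_eq_top (top_le_iff.1 (h'.trans (min_le_left _ _))),
      eq_zero_of_wFun_eq_top (top_le_iff.1 (h'.trans (min_le_right _ _))), add_zero, wFun_zero]
    exact le_top
  · have h' : (C : WithTop ℝ) ≤ min (wFun x) (wFun y) := h.ge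
    exact le_wFun_iff.2 (add_mem (le_wFun_iff.1 (h'.trans (min_le_left _ _)))
      (le_wFun_iff.1 (h'.trans (min_le_right _ _))))

theorem wFun_neg (x : UnifMeasure p) : wFun (-x) = wFun x := by
  obtain ⟨a, ha, hs⟩ := exists_series x
  have h1 := isLeast_wFun ha.neg (μ := -x) (by simpa using hs.neg)
  simp only [Pi.neg_apply, weight_neg] at h1
  exact h1.unique (isLeast_wFun ha hs)

theorem wFun_add_le_mul (x y : UnifMeasure p) : wFun x + wFun y ≤ wFun (x * y) := by
  rcases hx : wFun x with _ | C
  · rw [eq_zero_of_wFun_eq_top hx, zero_mul, wFun_zero]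
    exact le_top
  rcases hy : wFun y with _ | C'
  · rw [eq_zero_of_wFun_eq_top hy, mul_zero, wFun_zero]
    exact le_top
  exact le_wFun_iff.2 (mul_mem_weightClosure (le_wFun_iff.1 hx.ge) (le_wFun_iff.1 hy.ge))

theorem exists_leading_part {x : UnifMeasure p} {C : ℝ} (hx : wFun x = C) :
    ∃ f : S p →₀ ℤ_[p], f.support.Nonempty ∧ (∀ q ∈ f.support, weight (f q) q = C) ∧
      (C : WithTop ℝ) < wFun (x - f.sum fun q a => a • tPow q) := by
  classical
  obtain ⟨a, ha, hs⟩ := exists_series x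
  have hl := isLeast_wFun ha hs
  rw [hx] at hl
  have hfin : {q | weight (a q) q = C}.Finite := by
    -- The maximum with `1` only ensures a positive bound.
    refine (eventually_cofinite.1 (ha (max C 1) (by positivity))).subset fun q hq hlt => ?_
    rw [mem_ofPred_eq] at hq
    rw [hq, WithTop.coe_lt_coe] at hlt
    exact absurd hlt (not_lt.2 (le_max_left _ _))
  let f : S p →₀ ℤ_[p] := Finsupp.onFinset hfin.toFinset
    (fun q => if weight (a q) q = C then a q else 0) fun q hq => by
      rw [Finite.mem_toFinset]
      by_contra h
      exact hq (if_neg h)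
  have hf : ∀ q, f q = if weight (a q) q = C then a q else 0 := fun q => rfl
  refine ⟨f, ?_, fun q hq => ?_, ?_⟩
  · obtain ⟨q, hq⟩ := hl.1
    refine ⟨q, Finsupp.mem_support_iff.2 ?_⟩
    rw [hf, if_pos hq]
    intro h0
    simp [h0] at hq
  · rw [Finsupp.mem_support_iff, hf] at hq
    rw [hf]
    split_ifs at hq ⊢ with h
    · exact h
    · exact absurd rfl hq
  · have hr : ∀ q, (a - ⇑f) q = if weight (a q) q = C then 0 else a q := fun q => by
      rw [Pi.sub_apply, hf]
      split_ifs <;> simp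
    have hsub := hs.sub (hasSum_finsupp f)
    have hw : WeightsTendToTop (a - ⇑f) := by
      rw [sub_eq_add_neg]
      exact ha.add (weightsTendToTop_finsupp f).neg
    obtain ⟨q, hq⟩ := (isLeast_wFun hw (by simpa only [Pi.sub_apply, sub_smul] using hsub)).1
    rw [← hq]
    simp only [hr]
    split_ifs with h
    · rw [weight_zero]; exact WithTop.coe_lt_top C
    · exact lt_of_le_of_ne (hl.2 ⟨q, rfl⟩) (Ne.symm h)

/-- `q ↦ T̃ ^ q` as a homomorphism of monoids. -/
def tPowHom (p : ℕ) [Fact p.Prime] : Multiplicative (S p) →* UnifMeasure p where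
  toFun q := tPow q.toAdd
  map_one' := tPow_zero
  map_mul' _ _ := tPow_add _ _

theorem wFun_mul_le_of_homogeneous {f g : S p →₀ ℤ_[p]} {C C' : ℝ} (hf : f.support.Nonempty)
    (hg : g.support.Nonempty) (hfC : ∀ q ∈ f.support, weight (f q) q = C)
    (hgC : ∀ q ∈ g.support, weight (g q) q = C') :
    wFun ((f.sum fun q a => a • tPow q) * (g.sum fun q a => a • tPow q)) ≤
      ((C + C' : ℝ) : WithTop ℝ) := by
  obtain ⟨q, hq, hqmin⟩ := Finset.exists_min_image f.support (fun q => (q : ℝ)) hf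
  obtain ⟨r, hr, hrmin⟩ := Finset.exists_min_image g.support (fun q => (q : ℝ)) hg
  let F : AddMonoidAlgebra ℤ_[p] (S p) := .ofCoeff f
  let G : AddMonoidAlgebra ℤ_[p] (S p) := .ofCoeff g
  have hlift : ∀ h : AddMonoidAlgebra ℤ_[p] (S p),
      AddMonoidAlgebra.lift ℤ_[p] _ _ (tPowHom p) h = h.coeff.sum fun q a => a • tPow q :=
    fun h => AddMonoidAlgebra.lift_apply _ _
  have hFG : (f.sum fun q a => a • tPow q) * (g.sum fun q a => a • tPow q) =
      (F * G).coeff.sum fun q a => a • tPow q := by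
    rw [← hlift (F * G), map_mul, hlift, hlift]
  -- The sum of the two smallest exponents arises in one way only, so its coefficient is a single
  -- product, of weight `C + C'`.
  have hu : UniqueAdd F.coeff.support G.coeff.support q r := by
    intro q' r' hq' hr' h
    have h' := congrArg (Subtype.val : S p → ℝ) h
    simp only [AddSubmonoid.coe_add] at h'
    have h1 := hqmin q' hq'
    have h2 := hrmin r' hr'
    exact ⟨Subtype.ext (by linarith), Subtype.ext (by linarith)⟩
  have hc : (F * G).coeff (q + r) = f q * g r := AddMonoidAlgebra.coeff_mul_add_of_uniqueAdd hu
  rw [hFG]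
  refine ((isLeast_wFun (weightsTendToTop_finsupp _) (hasSum_finsupp _)).2 ⟨q + r, rfl⟩).trans ?_
  simp only [hc]
  rw [weight_mul, hfC q hq, hgC r hr, WithTop.coe_add]

theorem wFun_mul (x y : UnifMeasure p) : wFun (x * y) = wFun x + wFun y := by
  refine le_antisymm ?_ (wFun_add_le_mul x y)
  by_cases hxt : wFun x = ⊤
  · rw [hxt, top_add]; exact le_top
  by_cases hyt : wFun y = ⊤
  · rw [hyt, add_top]; exact le_top
  obtain ⟨C, hx⟩ := WithTop.ne_top_iff_exists.1 hxt
  obtain ⟨C', hy⟩ := WithTop.ne_top_iff_exists.1 hyt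
  replace hx := hx.symm
  replace hy := hy.symm
  rw [hx, hy, ← WithTop.coe_add]
  obtain ⟨f, hf, hfC, hfx⟩ := exists_leading_part hx
  obtain ⟨g, hg, hgC, hgy⟩ := exists_leading_part hy
  have h0 := wFun_mul_le_of_homogeneous hf hg hfC hgC
  have hfw : (C : WithTop ℝ) ≤ wFun (f.sum fun q a => a • tPow q) :=
    le_wFun_iff.2 (finiteSums_le_weightClosure _ (mem_finiteSums_of_finsupp f fun q => by
      by_cases hq : q ∈ f.support
      · exact (hfC q hq).ge
      · rw [Finsupp.notMem_support_iff.1 hq, weight_zero]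
        exact le_top))
  generalize (f.sum fun q a => a • tPow q) = x₀ at *
  generalize (g.sum fun q a => a • tPow q) = y₀ at *
  -- Replacing `x y` by the product of the leading parts changes it only in weight above `C + C'`,
  -- so that product would have weight above `C + C'` too.
  by_contra! H
  have h1 : ((C + C' : ℝ) : WithTop ℝ) < wFun (x₀ * (y - y₀)) := by
    refine lt_of_lt_of_le ?_ (wFun_add_le_mul _ _)
    rw [WithTop.coe_add]
    exact WithTop.add_lt_add_of_le_of_lt WithTop.coe_ne_top hfw hgy
  have h2 : ((C + C' : ℝ) : WithTop ℝ) < wFun ((x - x₀) * y) := by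
    refine lt_of_lt_of_le ?_ (wFun_add_le_mul _ _)
    rw [WithTop.coe_add]
    exact WithTop.add_lt_add_of_lt_of_le WithTop.coe_ne_top hfx hy.ge
  have h3 : ((C + C' : ℝ) : WithTop ℝ) < wFun (x * y + -(x₀ * (y - y₀) + (x - x₀) * y)) := by
    refine lt_of_lt_of_le (lt_min H ?_) (min_wFun_le_add _ _)
    rw [wFun_neg]
    exact lt_of_lt_of_le (lt_min h1 h2) (min_wFun_le_add _ _)
  have h4 : x * y + -(x₀ * (y - y₀) + (x - x₀) * y) = x₀ * y₀ := by ring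
  rw [h4] at h3
  exact absurd h3 (not_lt.2 h0)

/-- The valuation `w` on the ring of uniform measures. -/
def wVal (p : ℕ) [Fact p.Prime] : AddValuation (UnifMeasure p) (WithTop ℝ) :=
  AddValuation.of wFun wFun_zero wFun_one min_wFun_le_add wFun_mul

theorem wVal_apply (x : UnifMeasure p) : wVal p x = wFun x := rfl

theorem wVal_p : wVal p (p : UnifMeasure p) = ((1 : ℝ) : WithTop ℝ) := by
  have := wFun_smul_tPow (p := p) p 0
  rw [tPow_zero, ← natCast_mul_eq_smul, mul_one,
    weight_of_ne_zero padicInt_p_ne_zero, PadicInt.valuation_p] at this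
  rw [wVal_apply, this]
  simp

/-! ### Comparison of the topologies. -/

theorem hasBasis_nhds_zero_wVal : (𝓝 (0 : UnifMeasure p)).HasBasis (fun _ : ℕ => True)
    fun n => {x | ((n : ℝ) : WithTop ℝ) ≤ wVal p x} := by
  refine hasBasis_nhds_zero.to_hasBasis (fun n _ => ?_) fun n _ => ⟨n, trivial, fun x hx =>
    le_wFun_iff.2 (nbhdIdeal_le_weightClosure hx)⟩
  refine ⟨n * p ^ n + n, trivial, fun x hx => ?_⟩
  have hle : finiteSums p (n * p ^ n + n : ℝ) ≤ (nbhdIdeal p n n).toAddSubgroup := by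
    refine (AddSubgroup.closure_le _).2 ?_
    rintro _ ⟨a, q, ha, rfl⟩
    exact smul_tPow_mem_nbhdIdeal ha
  refine AddSubgroup.topologicalClosure_minimal _ hle (isClosed_nbhdIdeal n n) (le_wFun_iff.1 ?_)
  rw [← wVal_apply]
  simpa using hx

/-- A fundamental system of neighbourhoods of `0` for the topology of a valuation with an element
of valuation `1`. -/
theorem hasBasis_nhds_zero_valUniformSpace {A : Type} [CommRing A]
    (w : AddValuation A (WithTop ℝ)) (π : A) (hπ : w π = ((1 : ℝ) : WithTop ℝ)) :
    (@nhds A (valUniformSpace w).toTopologicalSpace 0).HasBasis (fun _ : ℕ => True)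
      fun n => {x | ((n : ℝ) : WithTop ℝ) ≤ w x} := by
  let : Valued A (Multiplicative (WithTop ℝ)ᵒᵈ) := Valued.mk' (AddValuation.toValuation w)
  have hv : ∀ x, (Valued.v x : Multiplicative (WithTop ℝ)ᵒᵈ) = .ofAdd (.toDual (w x)) :=
    fun x => rfl
  refine (Valued.hasBasis_nhds_zero A (Multiplicative (WithTop ℝ)ᵒᵈ)).to_hasBasis
    (fun γ _ => ?_) fun n _ => ?_
  · obtain ⟨g, hg⟩ : ∃ g : WithTop ℝ,
        MonoidWithZeroHom.ValueGroup₀.embedding γ.1 = Multiplicative.ofAdd (OrderDual.toDual g) :=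
      ⟨_, rfl⟩
    have hg' : g ≠ ⊤ := by
      rintro rfl
      exact (map_ne_zero MonoidWithZeroHom.ValueGroup₀.embedding).2 γ.ne_zero hg
    obtain ⟨C, rfl⟩ := WithTop.ne_top_iff_exists.1 hg'
    obtain ⟨n, hn⟩ := exists_nat_gt C
    refine ⟨n, trivial, fun x hx => ?_⟩
    rw [mem_ofPred_eq, Valuation.restrict_lt_iff_lt_embedding, hg, hv]
    have hx' : (C : WithTop ℝ) < w x := lt_of_lt_of_le (WithTop.coe_lt_coe.2 hn) hx
    exact hx'
  · have hw : w (π ^ n) = ((n : ℝ) : WithTop ℝ) := by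
      rw [AddValuation.map_pow, hπ, ← WithTop.coe_nsmul]
      simp
    -- The basis is indexed by the value group of `w` itself, which contains the value `n` thanks to
    -- `π^n`.
    have hne : Valued.v.restrict (π ^ n) ≠ 0 := by
      rw [Ne, Valuation.restrict_eq_zero_iff, hv, hw]
      exact fun h => WithTop.coe_ne_top (congrArg (fun x => OrderDual.ofDual x.toAdd) h)
    refine ⟨Units.mk0 _ hne, trivial, fun x hx => ?_⟩
    rw [mem_ofPred_eq, Units.val_mk0, Valuation.restrict_lt_iff, hv, hv] at hx
    have hx' : w (π ^ n) < w x := hx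
    rw [hw] at hx'
    exact hx'.le

theorem tPow_sFrac_zero (n : ℕ) : tPow (sFrac p 0 n) = tT p 0 ^ n := tPow_sFrac 0 n

theorem weight_shift (n : ℕ) (a : ℤ_[p]) (q : S p) :
    weight a (sFrac p 0 n + q) = ((n : ℝ) : WithTop ℝ) + weight a q := by
  have := weight_mul 1 a (sFrac p 0 n) q
  rw [one_mul, weight_of_ne_zero one_ne_zero, PadicInt.valuation_one, coe_sFrac] at this
  simpa using this

/-- The closure of the finite sums of terms of weight at least `C`, as an ideal. -/
def weightIdeal (p : ℕ) [Fact p.Prime] (C : ℝ) : Ideal (UnifMeasure p) where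
  __ := (weightClosure p C).toAddSubmonoid
  smul_mem' y x hx := by
    rw [smul_eq_mul, mul_comm]
    exact mul_mem_weightClosure_right hx y

theorem mem_weightIdeal {C : ℝ} {x : UnifMeasure p} :
    x ∈ weightIdeal p C ↔ x ∈ weightClosure p C := Iff.rfl

theorem span_pow_le_weightIdeal (n : ℕ) :
    Ideal.span {(p : UnifMeasure p), tT p 0} ^ n ≤ weightIdeal p n := by
  have h1 : Ideal.span {(p : UnifMeasure p), tT p 0} ≤ weightIdeal p 1 := by
    rw [Ideal.span_le, Set.insert_subset_iff, Set.singleton_subset_iff]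
    constructor
    · exact le_wFun_iff.1 (wVal_p (p := p)).ge
    · refine le_wFun_iff.1 ?_
      have := wFun_smul_tPow (p := p) 1 (sFrac p 0 1)
      rw [one_smul, tPow_sFrac_zero, pow_one, weight_of_ne_zero one_ne_zero, coe_sFrac] at this
      rw [this]
      simp
  induction n with
  | zero =>
    intro x _
    rw [mem_weightIdeal, Nat.cast_zero, weightClosure_zero]
    exact AddSubgroup.mem_top x
  | succ n ih =>
    rw [pow_succ, Ideal.mul_le]
    intro x hx y hy
    rw [mem_weightIdeal, Nat.cast_succ]
    exact mul_mem_weightClosure (ih hx) (h1 hy)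

theorem p_pow_dvd_of_hasSum {n : ℕ} {a : S p → ℤ_[p]} {μ : UnifMeasure p}
    (hs : HasSum (fun q => a q • tPow q) μ) (h : ∀ q, (p : ℤ_[p]) ^ n ∣ a q) :
    (p : UnifMeasure p) ^ n ∣ μ :=
  p_pow_dvd_iff.2 fun h' => hasSum_mem_of_isClosed (isClosed_nbhdIdeal h' n)
    (fun q => smul_mem_nbhdIdeal (h q) h' _) hs

theorem tT_pow_dvd_of_hasSum {n : ℕ} {a : S p → ℤ_[p]} {μ : UnifMeasure p}
    (ha : WeightsTendToTop a) (hs : HasSum (fun q => a q • tPow q) μ)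
    (h : ∀ q : S p, (q : ℝ) < n → a q = 0) : tT p 0 ^ n ∣ μ := by
  have he : Function.Injective fun q : S p => sFrac p 0 n + q := fun q r hqr => by
    have := congrArg (Subtype.val : S p → ℝ) hqr
    exact Subtype.ext (by simpa using this)
  have hb : WeightsTendToTop fun q => a (sFrac p 0 n + q) := fun C hC => by
    have := he.tendsto_cofinite.eventually (ha (n + C) (by positivity))
    filter_upwards [this] with q hq
    rw [weight_shift, WithTop.coe_add] at hq
    exact lt_of_add_lt_add_left hq
  refine ⟨∑' q, a (sFrac p 0 n + q) • tPow q, hs.unique ((he.hasSum_iff fun q hq => ?_).1 ?_)⟩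
  · rw [h q, zero_smul]
    by_contra! hn
    obtain ⟨s, rfl⟩ := exists_add_eq (r := sFrac p 0 n) (q := q) (by simpa [coe_sFrac] using hn)
    exact hq ⟨s, rfl⟩
  · convert! hb.summable.hasSum.mul_left (tT p 0 ^ n) using 2 with q
    rw [Function.comp_apply, tPow_add, tPow_sFrac_zero, mul_smul_comm]

/-- In a term of weight at least `2n`, an exponent below `n` forces `p^n` to divide the coefficient;
the terms of exponent at least `n` have the common factor `T̃^n`. -/
theorem weightIdeal_le_span_pow (n : ℕ) :
    weightIdeal p (2 * n : ℕ) ≤ Ideal.span {(p : UnifMeasure p), tT p 0} ^ n := by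
  classical
  intro μ hμ
  obtain ⟨a, ha, hs, hw⟩ := exists_series_of_mem_weightClosure (mem_weightIdeal.1 hμ)
  let b : S p → ℤ_[p] := fun q => if (q : ℝ) < n then a q else 0
  let c : S p → ℤ_[p] := fun q => if (q : ℝ) < n then 0 else a q
  have hb : WeightsTendToTop b := ha.mono fun q => by
    simp only [b]
    split_ifs <;> simp
  have hc : WeightsTendToTop c := ha.mono fun q => by
    simp only [c]
    split_ifs <;> simp
  have hbc : ∀ q, b q • tPow q + c q • tPow q = a q • tPow q := fun q => by
    simp only [b, c]
    split_ifs <;> simp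
  have hsum := hb.summable.hasSum.add hc.summable.hasSum
  simp only [hbc] at hsum
  rw [hs.unique hsum]
  refine add_mem ?_ ?_
  · refine Ideal.mem_of_dvd _ (p_pow_dvd_of_hasSum hb.summable.hasSum fun q => ?_)
      (Ideal.pow_mem_pow (Ideal.subset_span (by simp)) n)
    simp only [b]
    split_ifs with hq
    · refine (pow_dvd_pow _ ?_).trans (le_weight_iff.1 (hw q))
      have : (n : ℝ) ≤ ⌈((2 * n : ℕ) : ℝ) - q⌉₊ := by
        refine le_trans ?_ (Nat.le_ceil _)
        push_cast
        linarith
      exact_mod_cast this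
    · exact dvd_zero _
  · refine Ideal.mem_of_dvd _ (tT_pow_dvd_of_hasSum hc hc.summable.hasSum fun q hq => if_pos hq)
      (Ideal.pow_mem_pow (Ideal.subset_span (by simp)) n)

theorem valUniformSpace_isUniformAddGroup {A : Type} [CommRing A]
    (w : AddValuation A (WithTop ℝ)) : @IsUniformAddGroup A (valUniformSpace w) _ :=
  (Valued.mk' (AddValuation.toValuation w)).toIsUniformAddGroup

theorem valUniformSpace_wVal_topology :
    (valUniformSpace (wVal p)).toTopologicalSpace =
      (inferInstance : TopologicalSpace (UnifMeasure p)) := by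
  have := valUniformSpace_isUniformAddGroup (wVal p)
  refine IsTopologicalAddGroup.ext ?_ inferInstance ?_
  · exact @IsUniformAddGroup.to_topologicalAddGroup _ (valUniformSpace (wVal p)) _ this
  · exact (hasBasis_nhds_zero_valUniformSpace (wVal p) p wVal_p).eq_of_same_basis
      hasBasis_nhds_zero_wVal

theorem adicTopology_eq_natural :
    (Ideal.span {(p : UnifMeasure p), tT p 0}).adicTopology =
      (inferInstance : TopologicalSpace (UnifMeasure p)) := by
  refine IsTopologicalAddGroup.ext ?_ inferInstance ?_
  · exact @IsTopologicalRing.to_topologicalAddGroup _ _ (_)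
      (Ideal.span {(p : UnifMeasure p), tT p 0}).ringFilterBasis.isTopologicalRing
  · refine (Ideal.hasBasis_nhds_zero_adic _).ext hasBasis_nhds_zero_wVal (fun n _ => ?_)
      fun n _ => ⟨n, trivial, fun x hx => le_wFun_iff.2 (span_pow_le_weightIdeal n hx)⟩
    exact ⟨2 * n, trivial, fun x hx => weightIdeal_le_span_pow n (le_wFun_iff.1 hx)⟩

/-! ### The subring generated by the `T̃_n` and its completion. -/

theorem tPow_mem_ZT (q : S p) : tPow q ∈ ZT p :=
  pow_mem (Subring.subset_closure (mem_range_self _)) _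

theorem p_mem_ZT : (p : UnifMeasure p) ∈ ZT p := natCast_mem _ _

/-- The restriction of the valuation `w` to `ℤ[T̃ ^ (1 / p ^ ∞)]`. -/
def wValZT (p : ℕ) [Fact p.Prime] : AddValuation (ZT p) (WithTop ℝ) :=
  (wVal p).comap (ZT p).subtype

theorem wValZT_apply (x : ZT p) : wValZT p x = wFun (x : UnifMeasure p) := rfl

/-- Natural numbers are dense in `ℤ_p`, so the closure contains every `a T̃^q`; the closed span of
these is everything. -/
theorem closure_ZT : (ZT p).toAddSubgroup.topologicalClosure = ⊤ := by
  rw [eq_top_iff, ← weightClosure_zero]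
  refine AddSubgroup.topologicalClosure_minimal _ ((AddSubgroup.closure_le _).2 ?_)
    (AddSubgroup.isClosed_topologicalClosure _)
  rintro _ ⟨a, q, -, rfl⟩
  refine PadicInt.denseRange_natCast.induction_on a
    ((AddSubgroup.isClosed_topologicalClosure _).preimage (continuous_smul_const (tPow q)))
    fun m => AddSubgroup.le_topologicalClosure _ ?_
  rw [← natCast_mul_eq_smul]
  exact (ZT p).mul_mem (natCast_mem (ZT p) m) (tPow_mem_ZT q)

theorem isValuationCompletion_wValZT : IsValuationCompletion (wValZT p) (ZT p).subtype where
  isTopologicalRing := inferInstance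
  isUniformAddGroup := inferInstance
  completeSpace := inferInstance
  t2Space := inferInstance
  isUniformInducing := by
    have := valUniformSpace_isUniformAddGroup (wValZT p)
    refine @IsUniformInducing.mk _ _ (valUniformSpace (wValZT p)) _ _ ?_
    rw [uniformity_eq_comap_nhds_zero (UnifMeasure p),
      @uniformity_eq_comap_nhds_zero _ (valUniformSpace (wValZT p)), comap_comap]
    refine (hasBasis_nhds_zero_wVal.comap _).eq_of_same_basis ?_
    exact (hasBasis_nhds_zero_valUniformSpace (wValZT p) ⟨p, p_mem_ZT⟩ wVal_p).comap _
  denseRange := by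
    rw [DenseRange, dense_iff_closure_eq]
    have h : range (ZT p).subtype = ((ZT p).toAddSubgroup : Set (UnifMeasure p)) :=
      Subtype.range_coe
    rw [h, ← AddSubgroup.topologicalClosure_coe, closure_ZT]
    rfl

/-- The image of the monoid algebra `ℤ[S]` is a subring containing the generators. -/
theorem exists_finsupp_of_mem_ZT {x : UnifMeasure p} (hx : x ∈ ZT p) :
    ∃ a : S p →₀ ℤ, x = a.sum fun q n => n • tPow q := by
  have hle : ZT p ≤ (AddMonoidAlgebra.lift ℤ _ _ (tPowHom p)).toRingHom.range := by
    refine Subring.closure_le.2 ?_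
    rintro _ ⟨n, rfl⟩
    refine ⟨AddMonoidAlgebra.single (sFrac p n 1) 1, ?_⟩
    refine (AddMonoidAlgebra.lift_single (tPowHom p) _ _).trans ?_
    rw [one_smul]
    exact (tPow_sFrac n 1).trans (pow_one _)
  obtain ⟨f, rfl⟩ := hle hx
  exact ⟨f.coeff, AddMonoidAlgebra.lift_apply _ _⟩

theorem weightsTendToTop_intCast (a : S p →₀ ℤ) :
    WeightsTendToTop fun q => ((a q : ℤ) : ℤ_[p]) :=
  weightsTendToTop_finsupp (a.mapRange Int.cast Int.cast_zero)

theorem hasSum_intCast (a : S p →₀ ℤ) :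
    HasSum (fun q => ((a q : ℤ) : ℤ_[p]) • tPow q) (a.sum fun q n => n • tPow q) := by
  simp only [Int.cast_smul_eq_zsmul]
  exact hasSum_sum_of_ne_finset_zero fun q hq => by
    rw [Finsupp.notMem_support_iff.1 hq, zero_smul]

end PadicMeasures

end

open PadicMeasures
theorem corollary8p5 (p : ℕ) [Fact p.Prime] :
    -- `T̃_n` is the `p`-adic limit of `T_{n+m} ^ (p ^ m)`, and `T̃ ^ (m / p ^ n) = T̃_n ^ m`
    (∀ n : ℕ, Filter.Tendsto (fun m : ℕ => T p (n + m) ^ p ^ m) Filter.atTop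
      (@nhds _ (pAdicTopology p) (tT p n))) ∧
    (∀ (m n : ℕ) (q : S p), (q : ℝ) = m / (p : ℝ) ^ n → tPow q = tT p n ^ m) ∧
    -- the ring of uniform measures is the `w`-completion of `ℤ[T̃ ^ (1 / p ^ ∞)]`
    (∀ x : ZT p, ∃! a : S p →₀ ℤ, (x : UnifMeasure p) = a.sum fun q n => n • tPow q) ∧
    (∃ w₀ : AddValuation (ZT p) (WithTop ℝ),
      (∀ (x : ZT p) (a : S p →₀ ℤ), ((x : UnifMeasure p) = a.sum fun q n => n • tPow q) →
        IsLeast (Set.range fun q : S p => weight (a q : ℤ_[p]) q) (w₀ x)) ∧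
      IsValuationCompletion w₀ (ZT p).subtype) ∧
    -- expansions in `S`-series
    (∀ μ : UnifMeasure p, ∃! a : S p → ℤ_[p],
      WeightsTendToTop a ∧ HasSum (fun q => a q • tPow q) μ) ∧
    (∀ a : S p → ℤ_[p], WeightsTendToTop a → Summable fun q => a q • tPow q) ∧
    -- the valuation `w` induces the `(p, T̃)`-adic topology, which is also the natural one
    (∃ w : AddValuation (UnifMeasure p) (WithTop ℝ),
      (∀ (μ : UnifMeasure p) (a : S p → ℤ_[p]), WeightsTendToTop a →
        HasSum (fun q => a q • tPow q) μ →
          IsLeast (Set.range fun q : S p => weight (a q) q) (w μ)) ∧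
      (Ideal.span {(p : UnifMeasure p), tT p 0}).adicTopology =
        (valUniformSpace w).toTopologicalSpace ∧
      (valUniformSpace w).toTopologicalSpace =
        (inferInstance : TopologicalSpace (UnifMeasure p))) := by
  refine ⟨tendsto_tT, tPow_eq, fun x => ?_, ⟨wValZT p, fun x a hx => ?_,
    isValuationCompletion_wValZT⟩, fun μ => ?_, fun a ha => ha.summable,
    ⟨wVal p, fun μ a ha hs => isLeast_wFun ha hs,
      adicTopology_eq_natural.trans valUniformSpace_wVal_topology.symm,
      valUniformSpace_wVal_topology⟩⟩
  · obtain ⟨a, ha⟩ := exists_finsupp_of_mem_ZT x.2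
    refine ⟨a, ha, fun b hb => Finsupp.ext fun q => ?_⟩
    have := series_unique (weightsTendToTop_intCast b) (weightsTendToTop_intCast a)
      (hasSum_intCast b) (by rw [← hb, ha]; exact hasSum_intCast a)
    exact Int.cast_injective (congrFun this q)
  · rw [wValZT_apply, hx]
    exact isLeast_wFun (weightsTendToTop_intCast a) (hasSum_intCast a)
  · obtain ⟨a, ha, hs⟩ := exists_series μ
    exact ⟨a, ⟨ha, hs⟩, fun b hb => series_unique hb.1 ha hb.2 hs⟩
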